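/- Let $\Gamma$ be a countable discrete group and let $\Sigma=(\sigma_i\colon\Gamma\to S_{d_i})_{i\ge 1}$ be a sofic approximation of $\Gamma$: writing $u_d$ for the uniform probability measure on $\{1,\dots,d\}$, \[\lim_{i\to\infty} u_{d_i}(\{k:\sigma_i(g)\sigma_i(h)(k)=\sigma_i(gh)(k)\})=1\ \text{ for all } g,h\in\Gamma,\qquad \lim_{i\to\infty} u_{d_i}(\{k:\sigma_i(g)(k)\neq\sigma_i(h)(k)\})=1\ \text{ for all } g\neq h \text{ in } \Gamma.\] Entropy. Let $\Gamma\curvearrowright(Y,\nu)$ be a measure-preserving action on a standard probability space. A finite observable is a measurable map from $Y$ to a finite set. For a finite observable $\beta\colon Y\to B$, a finite $F\subseteq\Gamma$ containing the identity $e$, $\delta>0$ and $\sigma\colon\Gamma\to S_d$, let $\widetilde\beta^F\colon Y\to B^F$ be $\widetilde\beta^F(y)(g)=\beta(g^{-1}y)$, and let $\mathrm{AP}(\beta,F,\delta,\sigma)$ be the set of all $\phi\colon\{1,\dots,d\}\to B^F$ with \[\sum_{a\in B^F}\bigl|u_d(\phi^{-1}(\{a\}))-\nu((\widetilde\beta^F)^{-1}(\{a\}))\bigr|<\delta,\qquad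 u_d(\{j:\phi(j)(g)\neq\phi(\sigma(g)^{-1}(j))(e)\})<\delta\ \text{ for all } g\in F.\] The sofic entropy of the action with respect to $\Sigma$ is \[h_{\Sigma,\nu}(Y,\Gamma)=\sup_{\alpha}\ \inf_{\beta,\pi}\ \inf_{F,\delta}\ \limsup_{i\to\infty}\frac{1}{d_i}\log\bigl|\{\,j\mapsto\pi(\phi(j)(e)) : \phi\in\mathrm{AP}(\beta,F,\delta,\sigma_i)\}\bigr|\in[-\infty,\infty],\] where $\log 0=-\infty$, $\alpha\colon Y\to A$ runs over all finite observables, $\beta\colon Y\to B$ over all finite observables that refine $\alpha$ through a map $\pi\colon B\to A$ (that is, $\pi\circ\beta=\alpha$ almost everywhere), $F$ over the finite subsets of $\Gamma$ containing $e$, and $\delta$ over the positive reals. Statement. Let $\Gamma\curvearrowright(X,\mu)$ be a measure-preserving action on a standard probability space that has completely positive entropy with respect to $\Sigma$: whenever a measure-preserving action $\Gamma\curvearrowright(Y,\nu)$ on a standard probability space is a factor of $\Gamma\curvearrowright(X,\mu)$ (there is a measure-preserving, almost everywhere $\Gamma$-equivariant map $X\to Y$) and $(Y,\nu)$ is not a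 one-atom space, then $h_{\Sigma,\nu}(Y,\Gamma)>0$. Then the Koopman representation $\rho^0$ of $\Gamma$ on $L^2(X,\mu)\ominus\mathbb{C}1$, given by $(\rho^0(g)\xi)(x)=\xi(g^{-1}x)$, embeds into the countably infinite direct sum $\lambda_\Gamma^{\oplus\mathbb{N}}$ of the left regular representation $(\lambda_\Gamma(g)f)(x)=f(g^{-1}x)$ on $\ell^2(\Gamma)$; that is, there is a $\Gamma$-equivariant linear isometry from $L^2(X,\mu)\ominus\mathbb{C}1$ into $\ell^2(\Gamma)^{\oplus\mathbb{N}}$. -/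

import Mathlib

open MeasureTheory Filter Topology
open scoped ENNReal

/-! ## Unitary representations -/

/-- A unitary representation of the (discrete) group `Γ` on `H`. -/
abbrev UnitaryRep (Γ H : Type*) [Group Γ] [NormedAddCommGroup H] [InnerProductSpace ℂ H] :=
  Γ →* (H ≃ₗᵢ[ℂ] H)

namespace UnitaryRep

/-- A family of linear isometries `U g` with `U 1 = id` and `U (g * h) = U g ∘ U h` is a
unitary representation. -/
noncomputable def ofIsometries {Γ H : Type*} [Group Γ] [NormedAddCommGroup H]
    [InnerProductSpace ℂ H] (U : Γ → (H →ₗᵢ[ℂ] H)) (h1 : ∀ x, U 1 x = x)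
    (hmul : ∀ g h x, U (g * h) x = U g (U h x)) : UnitaryRep Γ H where
  toFun g :=
    { (U g).toLinearMap with
      invFun := U g⁻¹
      left_inv := fun x => by
        change U g⁻¹ (U g x) = x
        rw [← hmul, inv_mul_cancel, h1]
      right_inv := fun x => by
        change U g (U g⁻¹ x) = x
        rw [← hmul, mul_inv_cancel, h1]
      norm_map' := (U g).norm_map }
  map_one' := LinearIsometryEquiv.ext h1
  map_mul' g h := LinearIsometryEquiv.ext (hmul g h)

theorem ofIsometries_apply {Γ H : Type*} [Group Γ] [NormedAddCommGroup H]
    [InnerProductSpace ℂ H] (U : Γ → (H →ₗᵢ[ℂ] H)) (h1 : ∀ x, U 1 x = x)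
    (hmul : ∀ g h x, U (g * h) x = U g (U h x)) (g : Γ) (x : H) :
    ofIsometries U h1 hmul g x = U g x := rfl

/-- The restriction of a unitary representation to an invariant subspace. -/
noncomputable def restrict {Γ H : Type*} [Group Γ] [NormedAddCommGroup H]
    [InnerProductSpace ℂ H] (ρ : UnitaryRep Γ H) (K : Submodule ℂ H)
    (hK : ∀ g, ∀ x ∈ K, ρ g x ∈ K) : UnitaryRep Γ K :=
  ofIsometries
    (fun g =>
      { (ρ g).toLinearEquiv.toLinearMap.restrict (hK g) with
        norm_map' := fun x => (ρ g).norm_map (x : H) })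
    (fun x => Subtype.ext (by
      change ρ 1 (x : H) = x
      rw [map_one]; rfl))
    (fun g h x => Subtype.ext (by
      change ρ (g * h) (x : H) = ρ g (ρ h x)
      rw [map_mul]; rfl))

/-- The Hilbert space direct sum of copies of `ρ` indexed by `ι`, acting coordinatewise on
`ℓ²(ι, H)`. -/
noncomputable def directSum {Γ H : Type*} [Group Γ] [NormedAddCommGroup H]
    [InnerProductSpace ℂ H] (ι : Type*) (ρ : UnitaryRep Γ H) :
    UnitaryRep Γ (lp (fun _ : ι => H) 2) :=
  ofIsometries
    (fun g =>
      { toFun := fun f => ⟨fun i => ρ g (f i),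
          memℓp_norm_iff.1 (by
            simpa only [LinearIsometryEquiv.norm_map] using memℓp_norm_iff.2 (lp.memℓp f))⟩
        map_add' := fun f f' => lp.ext (funext fun i => (ρ g).map_add (f i) (f' i))
        map_smul' := fun c f => lp.ext (funext fun i => (ρ g).map_smul c (f i))
        norm_map' := fun f => by
          rw [lp.norm_eq_tsum_rpow (by norm_num), lp.norm_eq_tsum_rpow (by norm_num)]
          congr 1
          exact tsum_congr fun i => congrArg (· ^ _) ((ρ g).norm_map (f i)) })
    (fun f => lp.ext (funext fun i => by
      change ρ 1 (f i) = f i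
      rw [map_one]; rfl))
    (fun g h f => lp.ext (funext fun i => by
      change ρ (g * h) (f i) = ρ g (ρ h (f i))
      rw [map_mul]; rfl))

theorem directSum_apply {Γ H : Type*} [Group Γ] [NormedAddCommGroup H]
    [InnerProductSpace ℂ H] (ι : Type*) (ρ : UnitaryRep Γ H) (g : Γ)
    (f : lp (fun _ : ι => H) 2) (i : ι) : directSum ι ρ g f i = ρ g (f i) := rfl

/-- `ρ₁` is embeddable into `ρ₂`: there is an equivariant linear isometry. -/
def Embeds {Γ H₁ H₂ : Type*} [Group Γ] [NormedAddCommGroup H₁] [InnerProductSpace ℂ H₁]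
    [NormedAddCommGroup H₂] [InnerProductSpace ℂ H₂] (ρ₁ : UnitaryRep Γ H₁)
    (ρ₂ : UnitaryRep Γ H₂) : Prop :=
  ∃ V : H₁ →ₗᵢ[ℂ] H₂, ∀ g x, V (ρ₁ g x) = ρ₂ g (V x)

/-- The left regular representation on `ℓ²(Γ)`: `(λ(g) f)(x) = f (g⁻¹ x)`. -/
noncomputable def leftRegular (Γ : Type*) [Group Γ] :
    UnitaryRep Γ (lp (fun _ : Γ => ℂ) 2) :=
  ofIsometries
    (fun g =>
      { toFun := fun f => ⟨fun x => f (g⁻¹ * x), memℓp_gen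
          ((Equiv.mulLeft g⁻¹).summable_iff.2 ((lp.memℓp f).summable (by norm_num)))⟩
        map_add' := fun _ _ => lp.ext rfl
        map_smul' := fun _ _ => lp.ext rfl
        norm_map' := fun f => by
          rw [lp.norm_eq_tsum_rpow (by norm_num), lp.norm_eq_tsum_rpow (by norm_num)]
          congr 1
          exact (Equiv.mulLeft g⁻¹).tsum_eq (fun x => ‖f x‖ ^ _) })
    (fun f => lp.ext (funext fun x => by
      change f (1⁻¹ * x) = f x
      rw [inv_one, one_mul]))
    (fun g h f => lp.ext (funext fun x => by
      change f ((g * h)⁻¹ * x) = f (h⁻¹ * (g⁻¹ * x))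
      rw [mul_inv_rev, mul_assoc]))

theorem leftRegular_apply {Γ : Type*} [Group Γ] (g : Γ) (f : lp (fun _ : Γ => ℂ) 2) (x : Γ) :
    leftRegular Γ g f x = f (g⁻¹ * x) := rfl

/-- The representation `(ρ(g) ξ)(x) = ξ (g⁻¹ x)` on `L²(X, μ)`. -/
noncomputable def koopmanFull (Γ : Type*) [Group Γ] {X : Type*} [MeasurableSpace X]
    [MulAction Γ X] [MeasurableConstSMul Γ X] (μ : Measure X) [SMulInvariantMeasure Γ X μ] :
    UnitaryRep Γ (Lp ℂ 2 μ) :=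
  ofIsometries
    (fun g => Lp.compMeasurePreservingₗᵢ ℂ (fun x : X => g⁻¹ • x)
      (measurePreserving_smul g⁻¹ μ))
    (fun ξ => by
      refine Lp.ext ((Lp.coeFn_compMeasurePreserving ξ _).trans ?_)
      simp [Function.comp_def])
    (fun g h ξ => by
      refine Lp.ext ((Lp.coeFn_compMeasurePreserving ξ _).trans ?_)
      refine EventuallyEq.trans ?_ (Lp.coeFn_compMeasurePreserving _ _).symm
      refine EventuallyEq.trans ?_ ((measurePreserving_smul g⁻¹ μ).quasiMeasurePreserving.ae_eq
        (Lp.coeFn_compMeasurePreserving ξ (measurePreserving_smul h⁻¹ μ)).symm)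
      simp [Function.comp_def, mul_smul])

theorem koopmanFull_ae_eq {Γ : Type*} [Group Γ] {X : Type*} [MeasurableSpace X]
    [MulAction Γ X] [MeasurableConstSMul Γ X] (μ : Measure X) [SMulInvariantMeasure Γ X μ]
    (g : Γ) (ξ : Lp ℂ 2 μ) : koopmanFull Γ μ g ξ =ᵐ[μ] fun x => ξ (g⁻¹ • x) :=
  Lp.coeFn_compMeasurePreserving ξ (measurePreserving_smul g⁻¹ μ)

/-- `L²(X, μ) ⊖ ℂ1`. -/
noncomputable def L2Zero {X : Type*} [MeasurableSpace X] (μ : Measure X) [IsFiniteMeasure μ] :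
    Submodule ℂ (Lp ℂ 2 μ) :=
  (Submodule.span ℂ {Lp.const 2 μ (1 : ℂ)})ᗮ

theorem koopmanFull_mem_L2Zero {Γ : Type*} [Group Γ] {X : Type*} [MeasurableSpace X]
    [MulAction Γ X] [MeasurableConstSMul Γ X] (μ : Measure X) [IsFiniteMeasure μ]
    [SMulInvariantMeasure Γ X μ] (g : Γ) (ξ : Lp ℂ 2 μ) (hξ : ξ ∈ L2Zero μ) :
    koopmanFull Γ μ g ξ ∈ L2Zero μ := by
  have hc : koopmanFull Γ μ g (Lp.const 2 μ (1 : ℂ)) = Lp.const 2 μ (1 : ℂ) := rfl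
  rw [L2Zero, Submodule.mem_orthogonal_singleton_iff_inner_right] at hξ ⊢
  rw [← hc, LinearIsometryEquiv.inner_map_map, hξ]

/-- The Koopman representation `ρ⁰`: the restriction of `koopmanFull` to `L²(X, μ) ⊖ ℂ1`. -/
noncomputable def koopman (Γ : Type*) [Group Γ] {X : Type*} [MeasurableSpace X]
    [MulAction Γ X] [MeasurableConstSMul Γ X] (μ : Measure X) [IsFiniteMeasure μ]
    [SMulInvariantMeasure Γ X μ] : UnitaryRep Γ (L2Zero μ) :=
  (koopmanFull Γ μ).restrict (L2Zero μ) (koopmanFull_mem_L2Zero μ)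

end UnitaryRep

/-! ## Sofic approximations and sofic measure entropy -/

/-- The normalized counting (uniform probability) measure of a subset of a `d`-element set. -/
noncomputable def unifMeas (d : ℕ) (S : Set (Fin d)) : ℝ := (S.ncard : ℝ) / d

/-- A sofic approximation of `Γ`: maps `σ i : Γ → Sym(d i)`, not assumed to be homomorphisms,
that are asymptotically multiplicative and asymptotically free. -/
structure SoficApproximation (Γ : Type*) [Group Γ] where
  d : ℕ → ℕ
  σ : ∀ i, Γ → Equiv.Perm (Fin (d i))
  tendsto_mul : ∀ g h : Γ,
    Tendsto (fun i => unifMeas (d i) {k | σ i g (σ i h k) = σ i (g * h) k}) atTop (𝓝 1)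
  tendsto_free : ∀ g h : Γ, g ≠ h →
    Tendsto (fun i => unifMeas (d i) {k | σ i g k ≠ σ i h k}) atTop (𝓝 1)

namespace SoficEntropy

/-- For a finite observable `β : X → B` the map `x ↦ (g ↦ β (g⁻¹ x))` from `X` to `B ^ F`. -/
def itinerary {Γ X B : Type*} [Group Γ] [MulAction Γ X] (β : X → B) (F : Finset Γ) (x : X) :
    F → B :=
  fun g => β ((g : Γ)⁻¹ • x)

open Classical in
/-- The microstates `AP(β, F, δ, σ)`: maps `φ : {1, …, d} → B ^ F` whose distribution is
`δ`-close in `ℓ¹` to that of the `F`-itinerary of `β`, and which are `δ`-almost equivariant: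
`φ(j)(g) = φ(σ(g)⁻¹ j)(e)` outside a set of `j`'s of measure less than `δ`, for every `g ∈ F`. -/
def AP {Γ X : Type*} [Group Γ] [MeasurableSpace X] [MulAction Γ X] (μ : Measure X) {m d : ℕ}
    (β : X → Fin m) (F : Finset Γ) (hF : (1 : Γ) ∈ F) (δ : ℝ)
    (σ : Γ → Equiv.Perm (Fin d)) : Set (Fin d → (F → Fin m)) :=
  {φ | (∑ a : F → Fin m, |unifMeas d (φ ⁻¹' {a}) - μ.real (itinerary β F ⁻¹' {a})|) < δ ∧
    ∀ g : F, unifMeas d {j | φ j g ≠ φ ((σ g)⁻¹ j) ⟨1, hF⟩} < δ}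

/-- `h(α; β, F, δ)`, where `pr` is the map with `α = pr ∘ β` almost everywhere: the exponential
growth rate of the number of maps `j ↦ pr (φ(j)(e))` with `φ ∈ AP(β, F, δ, σ_i)`. The logarithm of
`0` is `-∞`. -/
noncomputable def hLoc {Γ X : Type*} [Group Γ] [MeasurableSpace X] [MulAction Γ X]
    (S : SoficApproximation Γ) (μ : Measure X) {k m : ℕ} (β : X → Fin m) (pr : Fin m → Fin k)
    (F : Finset Γ) (hF : (1 : Γ) ∈ F) (δ : ℝ) : EReal :=
  limsup (fun i =>
    ENNReal.log (((fun (φ : Fin (S.d i) → (F → Fin m)) j => pr (φ j ⟨1, hF⟩)) ''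
      AP μ β F hF δ (S.σ i)).ncard : ℝ≥0∞) / ((S.d i : ℝ) : EReal)) atTop

/-- `h(α)` for a finite observable `α`: the infimum of `h(α; β, F, δ)` over all finite observables
`β` refining `α` (through `pr`), all finite `F ⊆ Γ` containing `e`, and all `δ > 0`. -/
noncomputable def hObs {Γ X : Type*} [Group Γ] [MeasurableSpace X] [MulAction Γ X]
    (S : SoficApproximation Γ) (μ : Measure X) {k : ℕ} (α : X → Fin k) : EReal :=
  ⨅ (m : ℕ) (β : X → Fin m) (_ : Measurable β) (pr : Fin m → Fin k)
    (_ : ∀ᵐ x ∂μ, pr (β x) = α x) (F : Finset Γ) (hF : (1 : Γ) ∈ F) (δ : ℝ) (_ : 0 < δ),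
    hLoc S μ β pr F hF δ

/-- The sofic measure entropy `h_{Σ,μ}(X, Γ)`, with values in `{-∞} ∪ [0, ∞]`: the supremum of
`h(α)` over all finite observables `α`. -/
noncomputable def entropy {Γ X : Type*} [Group Γ] [MeasurableSpace X] [MulAction Γ X]
    (S : SoficApproximation Γ) (μ : Measure X) : EReal :=
  ⨆ (k : ℕ) (α : X → Fin k) (_ : Measurable α), hObs S μ α

end SoficEntropy

/-- `Γ ↷ (Y, ν)` is a factor of `Γ ↷ (X, μ)`: there is a measure-preserving map `X → Y` which is
almost everywhere equivariant. -/
def IsFactor (Γ : Type*) {X Y : Type*} [Group Γ] [MeasurableSpace X] [MulAction Γ X]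
    [MeasurableSpace Y] [MulAction Γ Y] (μ : Measure X) (ν : Measure Y) : Prop :=
  ∃ Φ : X → Y, MeasurePreserving Φ μ ν ∧ ∀ g : Γ, ∀ᵐ x ∂μ, Φ (g • x) = g • Φ x

/-- Completely positive entropy with respect to `S`: every factor (on a standard probability space)
that is not a one-atom space has positive entropy. Letting `Y` range over `Type` is no restriction,
whatever the universe of `X`: every standard Borel space is isomorphic to a Borel subset of `ℝ`. -/
def HasCompletelyPositiveEntropy {Γ X : Type*} [Group Γ] [MeasurableSpace X] [MulAction Γ X]
    (S : SoficApproximation Γ) (μ : Measure X) : Prop :=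
  ∀ (Y : Type) [MeasurableSpace Y] [StandardBorelSpace Y] [MulAction Γ Y]
    [MeasurableConstSMul Γ Y] (ν : Measure Y) [IsProbabilityMeasure ν]
    [SMulInvariantMeasure Γ Y ν],
    IsFactor Γ μ ν → (∀ y : Y, ν ≠ Measure.dirac y) → 0 < SoficEntropy.entropy S ν

/-!
Call a vector `ξ` of a representation `ρ` singular if `ρ(f) ξ` approximates `ξ` for suitable
finitely supported `f` of arbitrarily small `ℓ²`-norm.

A separable representation without nonzero singular vectors embeds in a multiple of the left regular
representation: the closure of `{(ρ(f) ξ, f)}` is then the graph of a closed operator, and cutting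
down the projection onto it gives an intertwiner into `ℓ²(Γ)` whose kernel is orthogonal to `ξ`. A
weighted sum of these over a dense sequence of `ξ` is injective, and its polar part is the isometry.

If a singular function `ζ` generates the σ-algebra, the entropy is at most `0`. A microstate gives a
vector of norm `≲ √d` in `ℂ^d` that is almost fixed by an operator of Hilbert–Schmidt norm
`≈ ‖f‖₂ √d`. Such vectors stay near a subspace of dimension much smaller than `d`, so at most
`e^{ηd}` of them are separated. The label of a point is nearly a Lipschitz function of finitely many
translates of `ζ`, so nearby vectors come from microstates with Hamming-close labellings.

A singular vector of the Koopman representation therefore generates a factor of entropy at most `0`,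
which is a one-atom space, so the vector is constant and, being orthogonal to `1`, zero.
-/

/-! ## Embedding into multiples of the left regular representation -/

theorem norm_sqrt_adjoint_comp_self_apply {E F : Type*} [NormedAddCommGroup E]
    [InnerProductSpace ℂ E] [CompleteSpace E] [NormedAddCommGroup F] [InnerProductSpace ℂ F]
    [CompleteSpace F] (A : E →L[ℂ] F) (x : E) : ‖CFC.sqrt (A.adjoint ∘L A) x‖ = ‖A x‖ := by
  set S : E →L[ℂ] E := CFC.sqrt (A.adjoint ∘L A)
  have hpos : 0 ≤ A.adjoint ∘L A :=
    (ContinuousLinearMap.nonneg_iff_isPositive _).2 A.isPositive_adjoint_comp_self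
  have hsq : S.adjoint ∘L S = A.adjoint ∘L A := by
    rw [(CFC.sqrt_nonneg (A.adjoint ∘L A)).isSelfAdjoint.adjoint_eq]
    exact CFC.sqrt_mul_sqrt_self _ hpos
  rw [ContinuousLinearMap.apply_norm_eq_sqrt_inner_adjoint_left, hsq,
    ← ContinuousLinearMap.apply_norm_eq_sqrt_inner_adjoint_left]

theorem denseRange_of_isSelfAdjoint_of_injective {𝕜 E : Type*} [RCLike 𝕜] [NormedAddCommGroup E]
    [InnerProductSpace 𝕜 E] [CompleteSpace E] {S : E →L[𝕜] E} (hS : IsSelfAdjoint S)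
    (hinj : Function.Injective S) : DenseRange S := by
  change Dense (S.range : Set E)
  rw [Submodule.dense_iff_topologicalClosure_eq_top, Submodule.topologicalClosure_eq_top_iff,
    ContinuousLinearMap.orthogonal_range, hS.adjoint_eq]
  exact LinearMap.ker_eq_bot.2 hinj

section Normed

variable {𝕜 E F G : Type*} [NontriviallyNormedField 𝕜] [NormedAddCommGroup E] [NormedSpace 𝕜 E]
  [NormedAddCommGroup F] [NormedSpace 𝕜 F] [NormedAddCommGroup G] [NormedSpace 𝕜 G]

theorem exists_linearIsometry_comp_eq [CompleteSpace G] (S : E →L[𝕜] F) (A : E →L[𝕜] G)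
    (hS : DenseRange S) (hnorm : ∀ x, ‖S x‖ = ‖A x‖) :
    ∃ V : F →ₗᵢ[𝕜] G, ∀ x, V (S x) = A x := by
  let V : F →L[𝕜] G := A.toLinearMap.extendOfNorm S.toLinearMap
  have hV (x : E) : V (S x) = A x :=
    LinearMap.extendOfNorm_eq hS ⟨1, fun x => ((hnorm x).ge.trans_eq (one_mul _).symm)⟩ x
  refine ⟨⟨V.toLinearMap, fun y => ?_⟩, hV⟩
  refine hS.induction_on (p := fun y => ‖V y‖ = ‖y‖) y
    (isClosed_eq (by fun_prop) (by fun_prop)) fun x => ?_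
  rw [hV, hnorm]

theorem exists_continuousLinearMap_lp_apply_eq {ι : Type*} (T : ι → E →L[𝕜] F)
    (hT : Summable fun i => ‖T i‖ ^ 2) :
    ∃ A : E →L[𝕜] lp (fun _ : ι => F) 2, ∀ x i, A x i = T i x := by
  have hle (x : E) (i : ι) : ‖T i x‖ ^ (2 : ℝ) ≤ ‖T i‖ ^ 2 * ‖x‖ ^ 2 := by
    rw [Real.rpow_two, ← mul_pow]
    exact pow_le_pow_left₀ (norm_nonneg _) ((T i).le_opNorm x) 2
  have hsum (x : E) : Summable fun i => ‖T i x‖ ^ (2 : ℝ) :=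
    .of_nonneg_of_le (fun _ => by positivity) (hle x) (hT.mul_right _)
  have hmem (x : E) : Memℓp (fun i => T i x) 2 := memℓp_gen (by simpa using hsum x)
  let A : E →ₗ[𝕜] lp (fun _ : ι => F) 2 :=
    { toFun := fun x => ⟨fun i => T i x, hmem x⟩
      map_add' := fun x y => lp.ext (funext fun i => (T i).map_add x y)
      map_smul' := fun c x => lp.ext (funext fun i => (T i).map_smul c x) }
  refine ⟨A.mkContinuous (√(∑' i, ‖T i‖ ^ 2)) fun x => ?_, fun _ _ => rfl⟩
  refine lp.norm_le_of_tsum_le (by norm_num) (by positivity) ?_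
  have hsq : (√(∑' i, ‖T i‖ ^ 2) * ‖x‖) ^ (2 : ℝ) = ∑' i, ‖T i‖ ^ 2 * ‖x‖ ^ 2 := by
    rw [Real.rpow_two, mul_pow, Real.sq_sqrt (tsum_nonneg fun _ => by positivity), tsum_mul_right]
  simpa [hsq] using! (hsum x).tsum_le_tsum (hle x) (hT.mul_right _)

end Normed

namespace UnitaryRep

variable {Γ H K : Type*} [Group Γ] [NormedAddCommGroup H] [InnerProductSpace ℂ H]
  [NormedAddCommGroup K] [InnerProductSpace ℂ K]

theorem apply_mul (ρ : UnitaryRep Γ H) (g h : Γ) (x : H) : ρ (g * h) x = ρ g (ρ h x) := by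
  rw [map_mul]; rfl

theorem apply_inv_apply (ρ : UnitaryRep Γ H) (g : Γ) (x : H) : ρ g (ρ g⁻¹ x) = x := by
  rw [← apply_mul, mul_inv_cancel, map_one]; rfl

theorem inner_apply_left (ρ : UnitaryRep Γ H) (g : Γ) (x y : H) :
    inner ℂ (ρ g x) y = inner ℂ x (ρ g⁻¹ y) := by
  rw [← (ρ g).inner_map_map x, apply_inv_apply]

theorem adjoint_apply_comm [CompleteSpace H] [CompleteSpace K] {ρ₁ : UnitaryRep Γ H}
    {ρ₂ : UnitaryRep Γ K} {A : H →L[ℂ] K} (hA : ∀ g x, A (ρ₁ g x) = ρ₂ g (A x)) (g : Γ) (y : K) :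
    A.adjoint (ρ₂ g y) = ρ₁ g (A.adjoint y) := by
  refine ext_inner_right ℂ fun x => ?_
  rw [ContinuousLinearMap.adjoint_inner_left, inner_apply_left, inner_apply_left, ← hA,
    ContinuousLinearMap.adjoint_inner_left]

theorem sqrt_adjoint_comp_self_apply_comm [CompleteSpace H] [CompleteSpace K]
    {ρ₁ : UnitaryRep Γ H} {ρ₂ : UnitaryRep Γ K} {A : H →L[ℂ] K}
    (hA : ∀ g x, A (ρ₁ g x) = ρ₂ g (A x)) (g : Γ) (x : H) :
    CFC.sqrt (A.adjoint ∘L A) (ρ₁ g x) = ρ₁ g (CFC.sqrt (A.adjoint ∘L A) x) := by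
  let u : H →L[ℂ] H := ((ρ₁ g).toContinuousLinearEquiv : H →L[ℂ] H)
  have hu : Commute (A.adjoint ∘L A) u := by
    ext v
    change A.adjoint (A (ρ₁ g v)) = ρ₁ g (A.adjoint (A v))
    rw [hA, adjoint_apply_comm hA]
  exact DFunLike.congr_fun (hu.cfcₙ_nnreal NNReal.sqrt).eq x

/-- The isometry is the polar part of the intertwiner. -/
theorem Embeds.of_injective [CompleteSpace H] [CompleteSpace K] {ρ₁ : UnitaryRep Γ H}
    {ρ₂ : UnitaryRep Γ K} (A : H →L[ℂ] K) (hinj : Function.Injective A)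
    (hA : ∀ g x, A (ρ₁ g x) = ρ₂ g (A x)) : Embeds ρ₁ ρ₂ := by
  set S : H →L[ℂ] H := CFC.sqrt (A.adjoint ∘L A)
  have hnorm (x : H) : ‖S x‖ = ‖A x‖ := norm_sqrt_adjoint_comp_self_apply A x
  have hSinj : Function.Injective S := by
    refine (injective_iff_map_eq_zero S).2 fun x hx => (injective_iff_map_eq_zero A).1 hinj x ?_
    rw [← norm_eq_zero, ← hnorm, hx, norm_zero]
  have hdense : DenseRange S :=
    denseRange_of_isSelfAdjoint_of_injective (CFC.sqrt_nonneg _).isSelfAdjoint hSinj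
  obtain ⟨V, hV⟩ := exists_linearIsometry_comp_eq S A hdense hnorm
  refine ⟨V, fun g x => hdense.induction_on (p := fun x => V (ρ₁ g x) = ρ₂ g (V x)) x
    (isClosed_eq (by fun_prop) (by fun_prop)) fun y => ?_⟩
  rw [← sqrt_adjoint_comp_self_apply_comm hA, hV, hV, hA]

/-- The orthogonal direct sum of two linear isometries. -/
noncomputable def prodIsometry (U : H →ₗᵢ[ℂ] H) (V : K →ₗᵢ[ℂ] K) :
    WithLp 2 (H × K) →ₗᵢ[ℂ] WithLp 2 (H × K) where
  toFun x := WithLp.toLp 2 (U x.fst, V x.snd)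
  map_add' x y := congrArg (WithLp.toLp 2) (Prod.ext (U.map_add _ _) (V.map_add _ _))
  map_smul' c x := congrArg (WithLp.toLp 2) (Prod.ext (U.map_smul _ _) (V.map_smul _ _))
  norm_map' x := by
    refine (sq_eq_sq₀ (norm_nonneg _) (norm_nonneg _)).1 ?_
    rw [WithLp.prod_norm_sq_eq_of_L2 x, ← U.norm_map x.fst, ← V.norm_map x.snd]
    exact WithLp.prod_norm_sq_eq_of_L2 (WithLp.toLp 2 (U x.fst, V x.snd))

/-- The orthogonal direct sum of two unitary representations. -/
noncomputable def prod (ρ₁ : UnitaryRep Γ H) (ρ₂ : UnitaryRep Γ K) :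
    UnitaryRep Γ (WithLp 2 (H × K)) :=
  ofIsometries (fun g => prodIsometry (ρ₁ g).toLinearIsometry (ρ₂ g).toLinearIsometry)
    (fun x => congrArg (WithLp.toLp 2) (Prod.ext
      (congrArg (fun u : H ≃ₗᵢ[ℂ] H => u x.fst) ρ₁.map_one)
      (congrArg (fun u : K ≃ₗᵢ[ℂ] K => u x.snd) ρ₂.map_one)))
    (fun g h x => congrArg (WithLp.toLp 2) (Prod.ext
      (apply_mul ρ₁ g h x.fst) (apply_mul ρ₂ g h x.snd)))

theorem prod_apply (ρ₁ : UnitaryRep Γ H) (ρ₂ : UnitaryRep Γ K) (g : Γ) (x : H) (y : K) :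
    prod ρ₁ ρ₂ g (WithLp.toLp 2 (x, y)) = WithLp.toLp 2 (ρ₁ g x, ρ₂ g y) := rfl

theorem starProjection_apply_comm (ρ : UnitaryRep Γ H) (M : Submodule ℂ H)
    [M.HasOrthogonalProjection] (hM : ∀ g, ∀ x ∈ M, ρ g x ∈ M) (g : Γ) (x : H) :
    M.starProjection (ρ g x) = ρ g (M.starProjection x) := by
  refine Submodule.eq_starProjection_of_mem_of_inner_eq_zero
    (hM g _ (Submodule.starProjection_apply_mem M x)) fun w hw => ?_
  rw [← map_sub, inner_apply_left]
  exact Submodule.starProjection_inner_eq_zero x _ (hM _ _ hw)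

/-- The action `f ↦ ρ(f) ξ = ∑ f(g) ρ(g) ξ` of the group algebra on a vector `ξ`. -/
noncomputable def orbitMap (ρ : UnitaryRep Γ H) (ξ : H) : (Γ →₀ ℂ) →ₗ[ℂ] H :=
  Finsupp.linearCombination ℂ fun g => ρ g ξ

theorem orbitMap_apply (ρ : UnitaryRep Γ H) (ξ : H) (f : Γ →₀ ℂ) :
    ρ.orbitMap ξ f = ∑ g ∈ f.support, f g • ρ g ξ := rfl

theorem orbitMap_mapDomain (ρ : UnitaryRep Γ H) (ξ : H) (g : Γ) (f : Γ →₀ ℂ) :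
    ρ.orbitMap ξ (f.mapDomain (g * ·)) = ρ g (ρ.orbitMap ξ f) := by
  rw [orbitMap, Finsupp.linearCombination_mapDomain, Finsupp.linearCombination_apply,
    Finsupp.linearCombination_apply, map_finsuppSum]
  simp only [map_smul, Function.comp_apply, apply_mul]

theorem map_orbitMap {ρ₁ : UnitaryRep Γ H} {ρ₂ : UnitaryRep Γ K} {T : H →L[ℂ] K}
    (hT : ∀ g x, T (ρ₁ g x) = ρ₂ g (T x)) (ξ : H) (f : Γ →₀ ℂ) :
    T (ρ₁.orbitMap ξ f) = ρ₂.orbitMap (T ξ) f := by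
  simp only [orbitMap_apply, map_sum, map_smul, hT]

open Classical in
/-- The inclusion of the finitely supported functions in `ℓ²(Γ)`. -/
noncomputable def finsuppToL2 (Γ : Type*) : (Γ →₀ ℂ) →ₗ[ℂ] lp (fun _ : Γ => ℂ) 2 :=
  Finsupp.linearCombination ℂ fun g => lp.single 2 g (1 : ℂ)

theorem norm_finsuppToL2_sq {Γ : Type*} (f : Γ →₀ ℂ) :
    ‖finsuppToL2 Γ f‖ ^ 2 = ∑ g ∈ f.support, ‖f g‖ ^ 2 := by
  classical
  have hf : finsuppToL2 Γ f = ∑ g ∈ f.support, lp.single 2 g (f g) := by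
    simp only [finsuppToL2, Finsupp.linearCombination_apply, Finsupp.sum, ← lp.single_smul,
      smul_eq_mul, mul_one]
  rw [hf]
  simpa using lp.norm_sum_single (p := 2) (E := fun _ : Γ => ℂ) (by norm_num) f f.support

theorem finsuppToL2_mapDomain (g : Γ) (f : Γ →₀ ℂ) :
    finsuppToL2 Γ (f.mapDomain (g * ·)) = leftRegular Γ g (finsuppToL2 Γ f) := by
  classical
  have hsingle (h : Γ) : (lp.single 2 (g * h) (1 : ℂ) : lp (fun _ : Γ => ℂ) 2) =
      leftRegular Γ g (lp.single 2 h 1) := by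
    ext x
    simp only [leftRegular_apply, lp.coeFn_single, Pi.single_apply, inv_mul_eq_iff_eq_mul]
  rw [finsuppToL2, Finsupp.linearCombination_mapDomain, Finsupp.linearCombination_apply,
    Finsupp.linearCombination_apply, map_finsuppSum]
  simp only [map_smul, Function.comp_apply, hsingle]

/-- A vector `ξ` is singular if finitely supported functions on `Γ` of arbitrarily small `ℓ²` norm
act on it almost as the identity. -/
def IsSingularVector (ρ : UnitaryRep Γ H) (ξ : H) : Prop :=
  ∀ ε > 0, ∃ f : Γ →₀ ℂ, ‖ρ.orbitMap ξ f - ξ‖ < ε ∧ ∑ g ∈ f.support, ‖f g‖ ^ 2 < ε ^ 2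

/-- The closure in `H ⊕ ℓ²(Γ)` of the set of pairs `(ρ(f) ξ, f)` with `f` finitely supported, that
is, of the inverse graph of the densely defined map `f ↦ ρ(f) ξ`. -/
noncomputable def orbitGraph (ρ : UnitaryRep Γ H) (ξ : H) :
    Submodule ℂ (WithLp 2 (H × lp (fun _ : Γ => ℂ) 2)) :=
  (LinearMap.range ((WithLp.linearEquiv 2 ℂ (H × lp (fun _ : Γ => ℂ) 2)).symm.toLinearMap ∘ₗ
    (ρ.orbitMap ξ).prod (finsuppToL2 Γ))).topologicalClosure

instance [CompleteSpace H] (ρ : UnitaryRep Γ H) (ξ : H) : CompleteSpace (ρ.orbitGraph ξ) :=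
  (Submodule.isClosed_topologicalClosure _).completeSpace_coe

theorem mk_orbitMap_mem_orbitGraph (ρ : UnitaryRep Γ H) (ξ : H) (f : Γ →₀ ℂ) :
    WithLp.toLp 2 (ρ.orbitMap ξ f, finsuppToL2 Γ f) ∈ ρ.orbitGraph ξ :=
  Submodule.le_topologicalClosure _ ⟨f, rfl⟩

theorem mem_orbitGraph_self (ρ : UnitaryRep Γ H) (ξ : H) :
    WithLp.toLp 2 (ξ, finsuppToL2 Γ (Finsupp.single 1 1)) ∈ ρ.orbitGraph ξ := by
  simpa [orbitMap] using mk_orbitMap_mem_orbitGraph ρ ξ (Finsupp.single 1 1)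

theorem orbitGraph_invariant (ρ : UnitaryRep Γ H) (ξ : H) (g : Γ)
    (x : WithLp 2 (H × lp (fun _ : Γ => ℂ) 2)) (hx : x ∈ ρ.orbitGraph ξ) :
    prod ρ (leftRegular Γ) g x ∈ ρ.orbitGraph ξ := by
  refine map_mem_closure (prod ρ (leftRegular Γ) g).continuous hx ?_
  rintro _ ⟨f, rfl⟩
  refine ⟨f.mapDomain (g * ·), ?_⟩
  change WithLp.toLp 2 (ρ.orbitMap ξ _, finsuppToL2 Γ _) =
    WithLp.toLp 2 (ρ g (ρ.orbitMap ξ f), leftRegular Γ g (finsuppToL2 Γ f))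
  rw [orbitMap_mapDomain, finsuppToL2_mapDomain]

theorem map_mem_orbitGraph {ρ₁ : UnitaryRep Γ H} {ρ₂ : UnitaryRep Γ K} {T : H →L[ℂ] K}
    (hT : ∀ g x, T (ρ₁ g x) = ρ₂ g (T x)) {ξ η : H} {f : lp (fun _ : Γ => ℂ) 2}
    (h : WithLp.toLp 2 (η, f) ∈ ρ₁.orbitGraph ξ) :
    WithLp.toLp 2 (T η, f) ∈ ρ₂.orbitGraph (T ξ) := by
  refine map_mem_closure (f := fun x : WithLp 2 (H × lp (fun _ : Γ => ℂ) 2) =>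
    WithLp.toLp 2 (T x.fst, x.snd)) (by fun_prop) h ?_
  rintro _ ⟨f, rfl⟩
  exact ⟨f, congrArg (WithLp.toLp 2) (Prod.ext (map_orbitMap hT ξ f).symm rfl)⟩

theorem isSingularVector_iff (ρ : UnitaryRep Γ H) (ξ : H) :
    ρ.IsSingularVector ξ ↔ WithLp.toLp 2 (ξ, 0) ∈ ρ.orbitGraph ξ := by
  have hdist (f : Γ →₀ ℂ) : dist (WithLp.toLp 2 (ξ, (0 : lp (fun _ : Γ => ℂ) 2)))
      (WithLp.toLp 2 (ρ.orbitMap ξ f, finsuppToL2 Γ f)) ^ 2 =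
      ‖ρ.orbitMap ξ f - ξ‖ ^ 2 + ∑ g ∈ f.support, ‖f g‖ ^ 2 := by
    rw [dist_comm, dist_eq_norm, WithLp.prod_norm_sq_eq_of_L2, ← norm_finsuppToL2_sq]
    simp
  rw [orbitGraph, ← SetLike.mem_coe, Submodule.topologicalClosure_coe, Metric.mem_closure_iff]
  constructor
  · intro h ε hε
    obtain ⟨f, hf, hf2⟩ := h (ε / 2) (by positivity)
    refine ⟨_, ⟨f, rfl⟩, lt_of_pow_lt_pow_left₀ 2 hε.le ((hdist f).trans_lt ?_)⟩
    nlinarith [pow_lt_pow_left₀ hf (norm_nonneg _) two_ne_zero]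
  · intro h ε hε
    obtain ⟨_, ⟨f, rfl⟩, hf⟩ := h ε hε
    have hlt := (hdist f).symm.trans_lt (pow_lt_pow_left₀ hf dist_nonneg two_ne_zero)
    have hsum : 0 ≤ ∑ g ∈ f.support, ‖f g‖ ^ 2 := by positivity
    exact ⟨f, lt_of_pow_lt_pow_left₀ 2 hε.le (by linarith),
      by linarith [sq_nonneg ‖ρ.orbitMap ξ f - ξ‖]⟩

/-- The multivalued part `{η | (η, 0) ∈ orbitGraph ρ ξ}` of the linear relation `orbitGraph ρ ξ`;
it vanishes if and only if that relation is the inverse graph of an operator. -/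
noncomputable def multivaluedPart (ρ : UnitaryRep Γ H) (ξ : H) : Submodule ℂ H :=
  (ρ.orbitGraph ξ).comap ((WithLp.linearEquiv 2 ℂ (H × lp (fun _ : Γ => ℂ) 2)).symm.toLinearMap ∘ₗ
    LinearMap.inl ℂ H (lp (fun _ : Γ => ℂ) 2))

theorem mem_multivaluedPart_iff {ρ : UnitaryRep Γ H} {ξ η : H} :
    η ∈ ρ.multivaluedPart ξ ↔ WithLp.toLp 2 (η, 0) ∈ ρ.orbitGraph ξ := Iff.rfl

instance [CompleteSpace H] (ρ : UnitaryRep Γ H) (ξ : H) : CompleteSpace (ρ.multivaluedPart ξ) :=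
  ((Submodule.isClosed_topologicalClosure _).preimage
    (f := fun η : H => WithLp.toLp 2 (η, (0 : lp (fun _ : Γ => ℂ) 2)))
    (by fun_prop)).completeSpace_coe

theorem multivaluedPart_invariant (ρ : UnitaryRep Γ H) (ξ : H) (g : Γ) (η : H)
    (hη : η ∈ ρ.multivaluedPart ξ) : ρ g η ∈ ρ.multivaluedPart ξ := by
  have h := orbitGraph_invariant ρ ξ g _ (mem_multivaluedPart_iff.1 hη)
  rwa [prod_apply, map_zero] at h

theorem fst_eq_zero_of_mem_orbitGraph_zero {ρ : UnitaryRep Γ H}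
    {x : WithLp 2 (H × lp (fun _ : Γ => ℂ) 2)}
    (hx : x ∈ ρ.orbitGraph 0) : x.fst = 0 := by
  have hclosed : IsClosed {x : WithLp 2 (H × lp (fun _ : Γ => ℂ) 2) | x.fst = 0} :=
    isClosed_eq (by fun_prop) continuous_const
  refine closure_minimal ?_ hclosed hx
  rintro _ ⟨f, rfl⟩
  change ρ.orbitMap 0 f = 0
  simp only [orbitMap_apply, map_zero, smul_zero, Finset.sum_const_zero]

/-- The projection of `ξ` onto its multivalued part is a singular vector that generates it. -/
theorem multivaluedPart_eq_bot [CompleteSpace H] {ρ : UnitaryRep Γ H}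
    (hρ : ∀ ξ, ρ.IsSingularVector ξ → ξ = 0) (ξ : H) : ρ.multivaluedPart ξ = ⊥ := by
  set P : H →L[ℂ] H := (ρ.multivaluedPart ξ).starProjection
  have hP : ∀ η ∈ ρ.multivaluedPart ξ, WithLp.toLp 2 (η, 0) ∈ ρ.orbitGraph (P ξ) := fun η hη => by
    have h := map_mem_orbitGraph
      (starProjection_apply_comm ρ _ (multivaluedPart_invariant ρ ξ)) (mem_multivaluedPart_iff.1 hη)
    rwa [Submodule.starProjection_eq_self_iff.2 hη] at h
  have hzero : P ξ = 0 := hρ _ ((isSingularVector_iff _ _).2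
    (hP _ (Submodule.starProjection_apply_mem _ ξ)))
  refine (Submodule.eq_bot_iff _).2 fun η hη => ?_
  have h := hP η hη
  rw [hzero] at h
  exact fst_eq_zero_of_mem_orbitGraph_zero h

/-- The compression to `ℓ²(Γ)` of the projection onto `orbitGraph ρ ξ`. -/
noncomputable def graphIntertwiner [CompleteSpace H] (ρ : UnitaryRep Γ H) (ξ : H) :
    H →L[ℂ] lp (fun _ : Γ => ℂ) 2 :=
  WithLp.sndL 2 ℂ H (lp (fun _ : Γ => ℂ) 2) ∘L (ρ.orbitGraph ξ).starProjection ∘L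
    ((WithLp.prodContinuousLinearEquiv 2 ℂ H (lp (fun _ : Γ => ℂ) 2)).symm :
      (H × lp (fun _ : Γ => ℂ) 2) →L[ℂ] WithLp 2 (H × lp (fun _ : Γ => ℂ) 2)) ∘L
    ContinuousLinearMap.inl ℂ H (lp (fun _ : Γ => ℂ) 2)

theorem graphIntertwiner_apply [CompleteSpace H] (ρ : UnitaryRep Γ H) (ξ x : H) :
    ρ.graphIntertwiner ξ x = ((ρ.orbitGraph ξ).starProjection (WithLp.toLp 2 (x, 0))).snd := rfl

theorem graphIntertwiner_comm [CompleteSpace H] (ρ : UnitaryRep Γ H) (ξ : H) (g : Γ) (x : H) :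
    ρ.graphIntertwiner ξ (ρ g x) = leftRegular Γ g (ρ.graphIntertwiner ξ x) := by
  have h := starProjection_apply_comm (prod ρ (leftRegular Γ)) (ρ.orbitGraph ξ)
    (orbitGraph_invariant ρ ξ) g (WithLp.toLp 2 (x, 0))
  rw [prod_apply, map_zero] at h
  rw [graphIntertwiner_apply, h]
  rfl

theorem norm_graphIntertwiner_le [CompleteSpace H] (ρ : UnitaryRep Γ H) (ξ : H) :
    ‖ρ.graphIntertwiner ξ‖ ≤ 1 := by
  refine ContinuousLinearMap.opNorm_le_bound _ zero_le_one fun x => ?_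
  calc ‖ρ.graphIntertwiner ξ x‖
      ≤ ‖(ρ.orbitGraph ξ).starProjection (WithLp.toLp 2 (x, 0))‖ := WithLp.norm_snd_le _ _
    _ ≤ ‖WithLp.toLp 2 (x, (0 : lp (fun _ : Γ => ℂ) 2))‖ :=
        Submodule.norm_starProjection_apply_le _ _
    _ = 1 * ‖x‖ := by rw [WithLp.norm_toLp_fst, one_mul]

theorem inner_eq_zero_of_graphIntertwiner_eq_zero [CompleteSpace H] {ρ : UnitaryRep Γ H}
    {ξ x : H} (hξ : ρ.multivaluedPart ξ = ⊥) (hx : ρ.graphIntertwiner ξ x = 0) :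
    inner ℂ x ξ = 0 := by
  set w := (ρ.orbitGraph ξ).starProjection (WithLp.toLp 2 (x, 0)) with hw
  have hwm : w.fst ∈ ρ.multivaluedPart ξ := by
    have hw2 : WithLp.toLp 2 (w.fst, 0) = w := by rw [← hx]; rfl
    rw [mem_multivaluedPart_iff, hw2]
    exact Submodule.starProjection_apply_mem _ _
  have hw0 : w = 0 := by
    rw [hξ, Submodule.mem_bot] at hwm
    exact WithLp.ofLp_injective 2 (Prod.ext hwm hx)
  have h := Submodule.starProjection_inner_eq_zero (K := ρ.orbitGraph ξ) (WithLp.toLp 2 (x, 0)) _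
    (mem_orbitGraph_self ρ ξ)
  rw [← hw, hw0, sub_zero, WithLp.prod_inner_apply] at h
  simpa using h

theorem embeds_of_forall_isSingularVector [CompleteSpace H] [TopologicalSpace.SeparableSpace H]
    {ρ : UnitaryRep Γ H} (hρ : ∀ ξ, ρ.IsSingularVector ξ → ξ = 0) :
    Embeds ρ (directSum ℕ (leftRegular Γ)) := by
  let ξ : ℕ → H := TopologicalSpace.denseSeq H
  have hnorm (n : ℕ) : ‖(1 / 2 : ℂ) ^ n • ρ.graphIntertwiner (ξ n)‖ ^ 2 ≤ (1 / 4) ^ n := by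
    rw [norm_smul, mul_pow, norm_pow, ← pow_mul, mul_comm n, pow_mul]
    norm_num only [norm_div, norm_one, RCLike.norm_ofNat]
    exact mul_le_of_le_one_right (by positivity)
      (pow_le_one₀ (norm_nonneg _) (norm_graphIntertwiner_le ρ _))
  obtain ⟨A, hA⟩ := exists_continuousLinearMap_lp_apply_eq
    (fun n => (1 / 2 : ℂ) ^ n • ρ.graphIntertwiner (ξ n))
    (.of_nonneg_of_le (fun _ => sq_nonneg _) hnorm
      (summable_geometric_of_lt_one (by norm_num) (by norm_num)))
  refine Embeds.of_injective A ((injective_iff_map_eq_zero A).2 fun x hx => ?_) fun g x => ?_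
  · refine (TopologicalSpace.denseRange_denseSeq H).eq_zero_of_inner_left ℂ fun n => ?_
    refine inner_eq_zero_of_graphIntertwiner_eq_zero (multivaluedPart_eq_bot hρ _) ?_
    have hn : (1 / 2 : ℂ) ^ n • ρ.graphIntertwiner (ξ n) x = 0 := by
      simpa [hx] using (hA x n).symm
    exact (smul_eq_zero_iff_right (by simp)).1 hn
  · refine lp.ext (funext fun n => ?_)
    simp only [directSum_apply, hA, smul_apply, map_smul,
      graphIntertwiner_comm]

end UnitaryRep

/-! ## Separated families of almost fixed vectors -/

theorem card_le_pow_of_pairwise_le_dist {ι E : Type*} [NormedAddCommGroup E] [NormedSpace ℝ E]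
    [FiniteDimensional ℝ E] (s : Finset ι) (c : ι → E) {R r : ℝ} (hR : 0 ≤ R) (hr : 0 < r)
    (hc : ∀ i ∈ s, ‖c i‖ ≤ R) (hsep : (s : Set ι).Pairwise fun i j => r ≤ dist (c i) (c j)) :
    (s.card : ℝ) ≤ (1 + 2 * R / r) ^ Module.finrank ℝ E := by
  borelize E
  let μ : Measure E := Measure.addHaar
  have hr2 : 0 < r / 2 := by positivity
  have hRr : 0 < R + r / 2 := by positivity
  have hdisj : (s : Set ι).Pairwise (Function.onFun Disjoint fun i => Metric.ball (c i) (r / 2)) :=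
    fun i hi j hj hij => Metric.ball_disjoint_ball ((add_halves r).trans_le (hsep hi hj hij))
  have hsub : (⋃ i ∈ s, Metric.ball (c i) (r / 2)) ⊆ Metric.ball (0 : E) (R + r / 2) :=
    Set.iUnion₂_subset fun i hi => Metric.ball_subset_ball' (by
      rw [dist_zero_right]; linarith [hc i hi])
  have hvol : (s.card : ℝ≥0∞) * ENNReal.ofReal ((r / 2) ^ Module.finrank ℝ E) *
      μ (Metric.ball 0 1) ≤
      ENNReal.ofReal ((R + r / 2) ^ Module.finrank ℝ E) * μ (Metric.ball 0 1) :=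
    calc
      _ = μ (⋃ i ∈ s, Metric.ball (c i) (r / 2)) := by
        rw [measure_biUnion_finset hdisj fun _ _ => measurableSet_ball]
        simp only [μ.addHaar_ball_of_pos _ hr2, Finset.sum_const, nsmul_eq_mul, mul_assoc]
      _ ≤ μ (Metric.ball (0 : E) (R + r / 2)) := measure_mono hsub
      _ = _ := μ.addHaar_ball_of_pos _ hRr
  have hcard := ENNReal.toReal_le_of_le_ofReal (pow_nonneg hRr.le _)
    ((ENNReal.mul_le_mul_iff_left (Metric.measure_ball_pos _ _ zero_lt_one).ne'
      measure_ball_lt_top.ne).1 hvol)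
  rw [ENNReal.toReal_mul, ENNReal.toReal_natCast, ENNReal.toReal_ofReal (by positivity)] at hcard
  have hbase : 1 + 2 * R / r = (R + r / 2) / (r / 2) := by field_simp; ring
  rwa [hbase, div_pow, le_div_iff₀ (by positivity)]

theorem card_le_pow_of_forall_exists_dist_le {ι E : Type*} [NormedAddCommGroup E]
    [NormedSpace ℝ E] (W : Submodule ℝ E) [FiniteDimensional ℝ W] (s : Finset ι) (c : ι → E)
    {R r : ℝ} (hR : 0 ≤ R) (hr : 0 < r) (hc : ∀ i ∈ s, ‖c i‖ ≤ R)
    (hW : ∀ i ∈ s, ∃ w ∈ W, dist (c i) w ≤ r / 4)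
    (hsep : (s : Set ι).Pairwise fun i j => r ≤ dist (c i) (c j)) :
    (s.card : ℝ) ≤ (2 + 4 * R / r) ^ Module.finrank ℝ W := by
  have hW' (i : ι) : ∃ w : W, i ∈ s → dist (c i) w ≤ r / 4 := by
    by_cases hi : i ∈ s
    · obtain ⟨w, hwW, hw⟩ := hW i hi
      exact ⟨⟨w, hwW⟩, fun _ => hw⟩
    · exact ⟨0, fun h => absurd h hi⟩
  choose w hw using hW'
  have hnorm : ∀ i ∈ s, ‖w i‖ ≤ R + r / 4 := fun i hi => by
    change ‖(w i : E)‖ ≤ R + r / 4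
    linarith [norm_le_norm_add_norm_sub (c i) (w i), dist_eq_norm (c i) (w i), hw i hi, hc i hi]
  have hdist : (s : Set ι).Pairwise fun i j => r / 2 ≤ dist (w i) (w j) := fun i hi j hj hij => by
    change r / 2 ≤ dist (w i : E) (w j)
    linarith [hsep hi hj hij, dist_triangle4_right (c i) (c j) (w i) (w j), hw i hi, hw j hj]
  have hcard := card_le_pow_of_pairwise_le_dist s w (by positivity) (half_pos hr) hnorm hdist
  have hbase : 1 + 2 * (R + r / 4) / (r / 2) = 2 + 4 * R / r := by field_simp; ring
  rwa [hbase] at hcard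

section HilbertSchmidt

variable {𝕜 E F ι κ : Type*} [RCLike 𝕜] [NormedAddCommGroup E] [InnerProductSpace 𝕜 E]
  [NormedAddCommGroup F] [InnerProductSpace 𝕜 F]

theorem norm_sum_sq_of_pairwise_inner_eq_zero {s : Finset ι} {v : ι → E}
    (hv : (s : Set ι).Pairwise fun i j => inner 𝕜 (v i) (v j) = 0) :
    ‖∑ i ∈ s, v i‖ ^ 2 = ∑ i ∈ s, ‖v i‖ ^ 2 := by
  have h : inner 𝕜 (∑ i ∈ s, v i) (∑ i ∈ s, v i) = ∑ i ∈ s, inner 𝕜 (v i) (v i) := by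
    rw [sum_inner]
    refine Finset.sum_congr rfl fun i hi => ?_
    rw [inner_sum]
    exact Finset.sum_eq_single_of_mem i hi fun j hj hji => hv hi hj hji.symm
  simp only [inner_self_eq_norm_sq_to_K] at h
  exact_mod_cast h

variable [FiniteDimensional 𝕜 E] [FiniteDimensional 𝕜 F]

theorem sum_norm_apply_sq_eq [Fintype ι] [Fintype κ] (T : E →ₗ[𝕜] F) (b : OrthonormalBasis ι 𝕜 E)
    (e : OrthonormalBasis κ 𝕜 E) : ∑ i, ‖T (b i)‖ ^ 2 = ∑ k, ‖T (e k)‖ ^ 2 := by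
  have h := (LinearMap.trace_eq_sum_inner (T.adjoint ∘ₗ T) b).symm.trans
    (LinearMap.trace_eq_sum_inner (T.adjoint ∘ₗ T) e)
  simp only [LinearMap.comp_apply, LinearMap.adjoint_inner_right, inner_self_eq_norm_sq_to_K] at h
  exact_mod_cast h

theorem exists_orthonormalBasis_pairwise_inner_apply_eq_zero (T : E →ₗ[𝕜] F) :
    ∃ e : OrthonormalBasis (Fin (Module.finrank 𝕜 E)) 𝕜 E,
      Pairwise fun i j => inner 𝕜 (T (e i)) (T (e j)) = 0 := by
  have hsymm : (T.adjoint ∘ₗ T).IsSymmetric := fun x y => by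
    simp [LinearMap.adjoint_inner_left, LinearMap.adjoint_inner_right]
  refine ⟨hsymm.eigenvectorBasis rfl, fun i j hij => ?_⟩
  change inner 𝕜 _ _ = 0
  rw [← LinearMap.adjoint_inner_right, ← LinearMap.comp_apply,
    hsymm.apply_eigenvectorBasis rfl j, inner_smul_right,
    (hsymm.eigenvectorBasis rfl).orthonormal.2 hij, mul_zero]

/-- Singular value truncation: the subspace is spanned by the images of the singular vectors whose
singular value is at least `δ`. -/
theorem exists_submodule_norm_apply_sub_le [Fintype ι] (b : OrthonormalBasis ι 𝕜 E)
    (T : E →ₗ[𝕜] F) {δ : ℝ} (hδ : 0 ≤ δ) : ∃ W : Submodule 𝕜 F,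
      (Module.finrank 𝕜 W : ℝ) * δ ^ 2 ≤ ∑ i, ‖T (b i)‖ ^ 2 ∧
      ∀ x, ∃ w ∈ W, ‖T x - w‖ ≤ δ * ‖x‖ := by
  classical
  obtain ⟨e, he⟩ := exists_orthonormalBasis_pairwise_inner_apply_eq_zero T
  let I : Finset (Fin (Module.finrank 𝕜 E)) := {i | δ ≤ ‖T (e i)‖}
  refine ⟨Submodule.span 𝕜 (I.image fun i => T (e i)), ?_, fun x => ?_⟩
  · have hrank : Module.finrank 𝕜 (Submodule.span 𝕜 (I.image fun i => T (e i) : Set F)) ≤ I.card :=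
      (finrank_span_finset_le_card _).trans Finset.card_image_le
    calc _ ≤ (I.card : ℝ) * δ ^ 2 := by gcongr
      _ ≤ ∑ i ∈ I, ‖T (e i)‖ ^ 2 := by
        rw [← nsmul_eq_mul]
        exact Finset.card_nsmul_le_sum _ _ _ fun i hi =>
          pow_le_pow_left₀ hδ (Finset.mem_filter.1 hi).2 2
      _ ≤ ∑ i, ‖T (e i)‖ ^ 2 :=
        Finset.sum_le_sum_of_subset_of_nonneg (Finset.subset_univ _) fun _ _ _ => by positivity
      _ = _ := sum_norm_apply_sq_eq T e b
  · refine ⟨∑ i ∈ I, e.repr x i • T (e i), Submodule.sum_mem _ fun i hi => Submodule.smul_mem _ _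
      (Submodule.subset_span (Finset.mem_coe.2 (Finset.mem_image_of_mem _ hi))), ?_⟩
    have hrest : T x - ∑ i ∈ I, e.repr x i • T (e i) = ∑ i ∈ Iᶜ, e.repr x i • T (e i) := by
      have hx : T x = ∑ i, e.repr x i • T (e i) := by
        conv_lhs => rw [← e.sum_repr x]
        simp only [map_sum, map_smul]
      rw [hx, ← Finset.sum_add_sum_compl I, add_sub_cancel_left]
    have horth : ((Iᶜ : Finset _) : Set (Fin _)).Pairwise fun i j =>
        inner 𝕜 (e.repr x i • T (e i)) (e.repr x j • T (e j)) = 0 := fun i _ j _ hij => by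
      change inner 𝕜 _ _ = 0
      rw [inner_smul_left, inner_smul_right, he hij, mul_zero, mul_zero]
    refine (sq_le_sq₀ (norm_nonneg _) (by positivity)).1 ?_
    rw [hrest, norm_sum_sq_of_pairwise_inner_eq_zero horth]
    calc ∑ i ∈ Iᶜ, ‖e.repr x i • T (e i)‖ ^ 2 ≤ ∑ i ∈ Iᶜ, δ ^ 2 * ‖e.repr x i‖ ^ 2 := by
          refine Finset.sum_le_sum fun i hi => ?_
          have hsmall : ‖T (e i)‖ ≤ δ := by
            simp only [I, Finset.mem_compl, Finset.mem_filter_univ, not_le] at hi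
            exact hi.le
          rw [norm_smul, mul_pow, mul_comm]
          gcongr
      _ ≤ ∑ i, δ ^ 2 * ‖e.repr x i‖ ^ 2 :=
          Finset.sum_le_sum_of_subset_of_nonneg (Finset.subset_univ _) fun _ _ _ => by positivity
      _ = (δ * ‖x‖) ^ 2 := by
          rw [← Finset.mul_sum, ← EuclideanSpace.norm_sq_eq, LinearIsometryEquiv.norm_map, mul_pow]

end HilbertSchmidt

theorem card_le_rpow_of_norm_sub_apply_le {ι κ E : Type*} [NormedAddCommGroup E]
    [InnerProductSpace ℂ E] [FiniteDimensional ℂ E] [Fintype κ] (b : OrthonormalBasis κ ℂ E)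
    (T : E →ₗ[ℂ] E) (s : Finset ι) (c : ι → E) {δ ε R r : ℝ} (hδ : 0 < δ) (hR : 0 ≤ R)
    (hr : 0 < r) (hεr : ε + δ * R ≤ r / 4) (hc : ∀ i ∈ s, ‖c i‖ ≤ R)
    (hT : ∀ i ∈ s, ‖c i - T (c i)‖ ≤ ε)
    (hsep : (s : Set ι).Pairwise fun i j => r ≤ dist (c i) (c j)) :
    (s.card : ℝ) ≤ (2 + 4 * R / r) ^ (2 * ((∑ k, ‖T (b k)‖ ^ 2) / δ ^ 2)) := by
  obtain ⟨W, hdim, hTW⟩ := exists_submodule_norm_apply_sub_le b T hδ.le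
  have hnear : ∀ i ∈ s, ∃ w ∈ W.restrictScalars ℝ, dist (c i) w ≤ r / 4 := fun i hi => by
    obtain ⟨w, hw, hTw⟩ := hTW (c i)
    refine ⟨w, hw, ?_⟩
    have hδR : δ * ‖c i‖ ≤ δ * R := by gcongr; exact hc i hi
    rw [dist_eq_norm]
    linarith [norm_sub_le_norm_sub_add_norm_sub (c i) (T (c i)) w, hT i hi]
  have hcard := card_le_pow_of_forall_exists_dist_le (W.restrictScalars ℝ) s c hR hr hc hnear hsep
  have hrank : Module.finrank ℝ (W.restrictScalars ℝ) = 2 * Module.finrank ℂ W :=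
    finrank_real_of_complex W
  rw [hrank, ← Real.rpow_natCast] at hcard
  refine hcard.trans (Real.rpow_le_rpow_of_exponent_le ?_ ?_)
  · linarith [show 0 ≤ 4 * R / r by positivity]
  · push_cast
    gcongr
    rwa [le_div_iff₀ (by positivity)]

/-! ## Hamming balls -/

section Hamming

variable {ι κ : Type*} [Fintype ι] [DecidableEq ι] [Fintype κ] [DecidableEq κ]

theorem sum_pow_hammingDist {R : Type*} [CommRing R] (a : ι → κ) (t : R) :
    ∑ b : ι → κ, t ^ hammingDist a b = (1 + (Fintype.card κ - 1) * t) ^ Fintype.card ι := by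
  have hprod (b : ι → κ) : t ^ hammingDist a b = ∏ j, if a j ≠ b j then t else 1 := by
    simp [hammingDist, Finset.prod_ite]
  have hsum (j : ι) : ∑ x : κ, (if a j ≠ x then t else 1) = 1 + (Fintype.card κ - 1) * t := by
    have hsplit (x : κ) : (if a j ≠ x then t else 1) = (if a j = x then 1 - t else 0) + t := by
      split_ifs <;> simp_all
    simp only [hsplit, Finset.sum_add_distrib, Finset.sum_ite_eq, Finset.mem_univ, if_true,
      Finset.sum_const, nsmul_eq_mul, Finset.card_univ]
    ring
  calc ∑ b : ι → κ, t ^ hammingDist a b = ∏ j, ∑ x : κ, if a j ≠ x then t else 1 := by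
        rw [Finset.prod_univ_sum, Fintype.piFinset_univ]
        exact Finset.sum_congr rfl fun b _ => hprod b
    _ = _ := by simp only [hsum, Finset.prod_const, Finset.card_univ]

/-- The words that differ from `a` in at most `ρ` places; the radius is real so that it can be a
fixed proportion of the length. -/
noncomputable def hammingBall (a : ι → κ) (ρ : ℝ) : Finset (ι → κ) :=
  {b | (hammingDist a b : ℝ) ≤ ρ}

theorem mem_hammingBall {a b : ι → κ} {ρ : ℝ} :
    b ∈ hammingBall a ρ ↔ (hammingDist a b : ℝ) ≤ ρ :=
  Finset.mem_filter_univ _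

theorem card_hammingBall_mul_rpow_le (a : ι → κ) (ρ : ℝ) {t : ℝ} (ht : 0 < t) (ht1 : t ≤ 1) :
    ((hammingBall a ρ).card : ℝ) * t ^ ρ ≤ Real.exp (Fintype.card κ * t * Fintype.card ι) :=
  calc ((hammingBall a ρ).card : ℝ) * t ^ ρ = ∑ _b ∈ hammingBall a ρ, t ^ ρ := by
        rw [Finset.sum_const, nsmul_eq_mul]
    _ ≤ ∑ b ∈ hammingBall a ρ, t ^ hammingDist a b := Finset.sum_le_sum fun b hb => by
        rw [← Real.rpow_natCast]
        exact Real.rpow_le_rpow_of_exponent_ge ht ht1 (mem_hammingBall.1 hb)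
    _ ≤ ∑ b : ι → κ, t ^ hammingDist a b :=
        Finset.sum_le_sum_of_subset_of_nonneg (Finset.subset_univ _) fun _ _ _ => by positivity
    _ = ((1 - t) + Fintype.card κ * t) ^ Fintype.card ι := by rw [sum_pow_hammingDist]; ring
    _ ≤ Real.exp (Fintype.card κ * t) ^ Fintype.card ι := by
        have : 0 ≤ 1 - t := sub_nonneg.2 ht1
        gcongr
        linarith [Real.add_one_le_exp (Fintype.card κ * t : ℝ)]
    _ = _ := by rw [← Real.exp_nat_mul, mul_comm]

end Hamming

theorem exists_card_hammingBall_le_exp (κ : Type*) [Fintype κ] [DecidableEq κ] {η : ℝ}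
    (hη : 0 < η) : ∃ θ > 0, ∀ {ι : Type*} [Fintype ι] [DecidableEq ι] (a : ι → κ),
    ((hammingBall a (θ * Fintype.card ι)).card : ℝ) ≤ Real.exp (η * Fintype.card ι) := by
  obtain ⟨t, ht, ht1, hκt⟩ : ∃ t : ℝ, 0 < t ∧ t ≤ 1 ∧ Fintype.card κ * t ≤ η / 2 := by
    refine ⟨min 1 (η / 2 / (Fintype.card κ + 1)), by positivity, min_le_left _ _, ?_⟩
    calc (Fintype.card κ : ℝ) * min 1 (η / 2 / (Fintype.card κ + 1))
        ≤ (Fintype.card κ + 1) * (η / 2 / (Fintype.card κ + 1)) := by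
          gcongr
          · linarith
          · exact min_le_right _ _
      _ = η / 2 := by field_simp
  have hlog : 0 < 1 - Real.log t := by linarith [Real.log_nonpos ht.le ht1]
  refine ⟨η / 2 / (1 - Real.log t), by positivity, fun {ι} _ _ a => ?_⟩
  set θ := η / 2 / (1 - Real.log t)
  have hθt : -(θ * Real.log t) ≤ η / 2 := by
    have hθ0 : 0 < θ := by positivity
    linarith [show θ * (1 - Real.log t) = η / 2 from div_mul_cancel₀ _ hlog.ne']
  have hball := card_hammingBall_mul_rpow_le a (θ * Fintype.card ι) ht ht1
  rw [← le_div_iff₀ (by positivity), Real.rpow_def_of_pos ht, ← Real.exp_sub] at hball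
  refine hball.trans (Real.exp_le_exp.2 ?_)
  calc _ = (Fintype.card κ * t + -(θ * Real.log t)) * Fintype.card ι := by ring
    _ ≤ (η / 2 + η / 2) * Fintype.card ι := by gcongr
    _ = _ := by ring

theorem exists_subset_pairwise_le_dist {α E : Type*} [PseudoMetricSpace E] (s : Finset α)
    (c : α → E) {r : ℝ} (hr : 0 < r) : ∃ t ⊆ s,
      (t : Set α).Pairwise (fun a b => r ≤ dist (c a) (c b)) ∧
      ∀ a ∈ s, ∃ b ∈ t, dist (c b) (c a) < r := by
  classical
  let P : Finset (Finset α) :=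
    {t ∈ s.powerset | (t : Set α).Pairwise fun a b => r ≤ dist (c a) (c b)}
  obtain ⟨t, ht⟩ := P.exists_maximal ⟨∅, by simp [P]⟩
  simp only [P, Finset.mem_filter, Finset.mem_powerset] at ht
  refine ⟨t, ht.prop.1, ht.prop.2, fun a ha => ?_⟩
  by_contra! hfar
  have hat : a ∈ t := ht.le_of_ge ⟨Finset.insert_subset ha ht.prop.1, by
    rw [Finset.coe_insert]
    exact ht.prop.2.insert fun b hb _ => ⟨dist_comm (c a) (c b) ▸ hfar b hb, hfar b hb⟩⟩
    (Finset.subset_insert a t) (Finset.mem_insert_self a t)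
  exact hr.not_ge (dist_self (c a) ▸ hfar a hat)

/-! ## Group algebra elements acting on sofic approximations -/

/-- The action `∑ g, f g σ(g)` of an element of the group algebra on `ℂ^d`, where the permutation
`σ(g)` acts by `(σ(g) c) j = c (σ(g)⁻¹ j)`. -/
noncomputable def soficOperator {Γ : Type*} {d : ℕ} (σ : Γ → Equiv.Perm (Fin d)) (f : Γ →₀ ℂ) :
    EuclideanSpace ℂ (Fin d) →ₗ[ℂ] EuclideanSpace ℂ (Fin d) :=
  ∑ g ∈ f.support, f g • (LinearIsometryEquiv.piLpCongrLeft 2 ℂ ℂ (σ g)).toLinearMap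

section SoficOperator

variable {Γ : Type*} {d : ℕ} (σ : Γ → Equiv.Perm (Fin d)) (f : Γ →₀ ℂ)

theorem soficOperator_apply (c : EuclideanSpace ℂ (Fin d)) (j : Fin d) :
    soficOperator σ f c j = ∑ g ∈ f.support, f g * c ((σ g)⁻¹ j) := by
  simp [soficOperator, LinearIsometryEquiv.piLpCongrLeft_apply, Equiv.piCongrLeft'_apply]

theorem soficOperator_basisFun (k : Fin d) :
    soficOperator σ f (EuclideanSpace.basisFun (Fin d) ℂ k) =
      ∑ g ∈ f.support, f g • EuclideanSpace.basisFun (Fin d) ℂ (σ g k) := by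
  simp [soficOperator]

theorem sum_norm_soficOperator_basisFun_sq :
    ((∑ k, ‖soficOperator σ f (EuclideanSpace.basisFun _ ℂ k)‖ ^ 2 : ℝ) : ℂ) =
      ∑ g ∈ f.support, ∑ h ∈ f.support,
        starRingEnd ℂ (f g) * f h * ({k | σ g k = σ h k} : Set (Fin d)).ncard := by
  have hk (k : Fin d) : ((‖soficOperator σ f (EuclideanSpace.basisFun _ ℂ k)‖ ^ 2 : ℝ) : ℂ) =
      ∑ g ∈ f.support, ∑ h ∈ f.support,
        starRingEnd ℂ (f g) * f h * if σ g k = σ h k then 1 else 0 := by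
    have hinner := inner_self_eq_norm_sq_to_K (𝕜 := ℂ)
      (soficOperator σ f (EuclideanSpace.basisFun _ ℂ k))
    push_cast
    refine hinner.symm.trans ?_
    simp only [soficOperator_basisFun, sum_inner, inner_sum, inner_smul_left, inner_smul_right,
      orthonormal_iff_ite.1 (EuclideanSpace.basisFun (Fin d) ℂ).orthonormal, mul_assoc]
    rw [Finset.sum_comm]
    refine Finset.sum_congr rfl fun h _ => ?_
    rw [Finset.mul_sum]
    exact Finset.sum_congr rfl fun g _ => mul_left_comm _ _ _
  have hcard (g h : Γ) : (({k | σ g k = σ h k} : Set (Fin d)).ncard : ℂ) =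
      ∑ k, if σ g k = σ h k then 1 else 0 := by
    rw [Finset.sum_boole, Set.ncard_eq_toFinset_card', Set.toFinset_ofPred]
  rw [Complex.ofReal_sum]
  simp only [hk, hcard, Finset.mul_sum]
  rw [Finset.sum_comm]
  exact Finset.sum_congr rfl fun g _ => Finset.sum_comm

end SoficOperator

section SoficApproximation

variable {Γ : Type*} [Group Γ] (S : SoficApproximation Γ)

theorem SoficApproximation.eventually_d_pos : ∀ᶠ i in atTop, 0 < S.d i := by
  filter_upwards [(S.tendsto_mul 1 1).eventually_ne one_ne_zero] with i hi
  exact Nat.pos_of_ne_zero fun h => hi (by simp [unifMeas, h])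

theorem unifMeas_add_unifMeas_compl {d : ℕ} (hd : 0 < d) (s : Set (Fin d)) :
    unifMeas d s + unifMeas d sᶜ = 1 := by
  rw [unifMeas, unifMeas, ← add_div, ← Nat.cast_add, Set.ncard_add_ncard_compl, Nat.card_fin,
    div_self (by positivity)]

theorem SoficApproximation.tendsto_unifMeas_eq (g h : Γ) [Decidable (g = h)] :
    Tendsto (fun i => unifMeas (S.d i) {k | S.σ i g k = S.σ i h k}) atTop
      (𝓝 (if g = h then 1 else 0)) := by
  split_ifs with hgh
  · subst hgh
    refine tendsto_const_nhds.congr' ?_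
    filter_upwards [S.eventually_d_pos] with i hi
    simp [unifMeas, Set.ncard_univ, hi.ne']
  · rw [← sub_self 1]
    refine ((S.tendsto_free g h hgh).const_sub 1).congr' ?_
    filter_upwards [S.eventually_d_pos] with i hi
    exact sub_eq_of_eq_add (unifMeas_add_unifMeas_compl hi _).symm

theorem SoficApproximation.tendsto_hilbertSchmidt (f : Γ →₀ ℂ) :
    Tendsto
      (fun i => (∑ k, ‖soficOperator (S.σ i) f (EuclideanSpace.basisFun _ ℂ k)‖ ^ 2) / S.d i)
      atTop (𝓝 (∑ g ∈ f.support, ‖f g‖ ^ 2)) := by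
  classical
  have hlim : Tendsto (fun i => ∑ g ∈ f.support, ∑ h ∈ f.support, starRingEnd ℂ (f g) * f h *
      (unifMeas (S.d i) {k | S.σ i g k = S.σ i h k} : ℂ)) atTop
      (𝓝 (∑ g ∈ f.support, ∑ h ∈ f.support,
        starRingEnd ℂ (f g) * f h * ((if g = h then 1 else 0 : ℝ) : ℂ))) :=
    tendsto_finsetSum _ fun g _ => tendsto_finsetSum _ fun h _ =>
      ((Complex.continuous_ofReal.tendsto _).comp (S.tendsto_unifMeas_eq g h)).const_mul _
  have hnorm : ∑ g ∈ f.support, ∑ h ∈ f.support,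
      starRingEnd ℂ (f g) * f h * ((if g = h then 1 else 0 : ℝ) : ℂ) =
      ((∑ g ∈ f.support, ‖f g‖ ^ 2 : ℝ) : ℂ) := by
    rw [Complex.ofReal_sum]
    refine Finset.sum_congr rfl fun g hg => ?_
    rw [Finset.sum_eq_single_of_mem g hg fun h _ hgh => by simp [hgh.symm], if_pos rfl,
      Complex.conj_mul']
    simp
  rw [hnorm] at hlim
  refine ((Complex.continuous_re.tendsto _).comp hlim).congr fun i => ?_
  rw [Function.comp_apply, ← Complex.ofReal_re (_ / _), Complex.ofReal_div,
    sum_norm_soficOperator_basisFun_sq, Finset.sum_div]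
  simp only [Finset.sum_div, unifMeas, Complex.ofReal_div, Complex.ofReal_natCast, mul_div_assoc]

end SoficApproximation

/-! ## Lipschitz cylinder functions -/

section Cylinder

open scoped NNReal

variable {ι V : Type*} [PseudoMetricSpace V]

/-- `G` is a function of the coordinates in `F` only, and is `L`-Lipschitz in them for the `ℓ¹`
distance. -/
def CylinderLipschitz (F : Finset ι) (L : ℝ≥0) (G : (ι → V) → ℝ) : Prop :=
  ∀ z z', |G z - G z'| ≤ L * ∑ i ∈ F, dist (z i) (z' i)

namespace CylinderLipschitz

variable {F F' : Finset ι} {L L' : ℝ≥0} {G G' : (ι → V) → ℝ}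

theorem mono (hG : CylinderLipschitz F L G) (hF : F ⊆ F') (hL : L ≤ L') :
    CylinderLipschitz F' L' G := fun z z' =>
  (hG z z').trans (mul_le_mul (NNReal.coe_le_coe.2 hL)
    (Finset.sum_le_sum_of_subset_of_nonneg hF fun _ _ _ => dist_nonneg)
    (Finset.sum_nonneg fun _ _ => dist_nonneg) L'.coe_nonneg)

theorem const_sub (c : ℝ) (hG : CylinderLipschitz F L G) :
    CylinderLipschitz F L fun z => c - G z := fun z z' => by
  rw [sub_sub_sub_cancel_left, abs_sub_comm]
  exact hG z z'

theorem max [DecidableEq ι] (hG : CylinderLipschitz F L G) (hG' : CylinderLipschitz F' L' G') :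
    CylinderLipschitz (F ∪ F') (max L L') fun z => max (G z) (G' z) := fun z z' =>
  (abs_max_sub_max_le_max _ _ _ _).trans (max_le
    (hG.mono Finset.subset_union_left (le_max_left _ _) z z')
    (hG'.mono Finset.subset_union_right (le_max_right _ _) z z'))

theorem continuous (hG : CylinderLipschitz F L G) : Continuous G := by
  refine continuous_iff_continuousAt.2 fun z => tendsto_iff_dist_tendsto_zero.2
    (squeeze_zero (fun _ => dist_nonneg) (fun z' => hG z' z) ?_)
  have hsum : Continuous fun z' : ι → V => (L : ℝ) * ∑ i ∈ F, dist (z' i) (z i) := by fun_prop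
  simpa using hsum.tendsto z

theorem congr (hG : CylinderLipschitz F L G) {z z' : ι → V} (h : ∀ i ∈ F, z i = z' i) :
    G z = G z' := by
  have hle := hG z z'
  rw [Finset.sum_eq_zero fun i hi => by rw [h i hi, dist_self], mul_zero] at hle
  exact sub_eq_zero.1 (abs_nonpos_iff.1 hle)

end CylinderLipschitz

variable [MeasurableSpace V]

theorem exists_lipschitzWith_eLpNorm_indicator_sub_le [BorelSpace V] (ν : Measure V)
    [IsFiniteMeasure ν] {C : Set V} (hC : IsClosed C) {ε : ℝ≥0∞} (hε : ε ≠ 0) :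
    ∃ (L : ℝ≥0) (G : V → ℝ), LipschitzWith L G ∧ eLpNorm (C.indicator 1 - G) 1 ν ≤ ε := by
  have hclose : ∀ᶠ δ in 𝓝[>] (0 : ℝ), ν (Metric.thickening δ C) < ν C + ε :=
    (tendsto_measure_thickening_of_isClosed ⟨1, one_pos, measure_ne_top _ _⟩ hC).eventually_lt_const
      (ENNReal.lt_add_right (measure_ne_top _ _) hε)
  obtain ⟨δ, hδε, hδ : 0 < δ⟩ := (hclose.and self_mem_nhdsWithin).exists
  have hbound (w : V) : |C.indicator 1 w - (thickenedIndicator hδ C w : ℝ)| ≤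
      (Metric.thickening δ C \ C).indicator 1 w := by
    by_cases hw : w ∈ C
    · rw [thickenedIndicator_one hδ C hw]
      simp [hw]
    by_cases hw' : w ∈ Metric.thickening δ C
    · have hle : (thickenedIndicator hδ C w : ℝ) ≤ 1 := thickenedIndicator_le_one hδ C w
      rw [Set.indicator_of_notMem hw, Set.indicator_of_mem (Set.mem_sdiff_of_mem hw' hw),
        zero_sub, abs_neg, NNReal.abs_eq]
      exact hle
    · rw [thickenedIndicator_zero hδ C hw']
      simp [hw, hw']
  refine ⟨_, fun w => thickenedIndicator hδ C w,
    fun w w' => lipschitzWith_thickenedIndicator hδ C w w', (eLpNorm_mono_real hbound).trans ?_⟩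
  refine (eLpNorm_indicator_const (c := (1 : ℝ))
    (Metric.isOpen_thickening.measurableSet.diff hC.measurableSet) one_ne_zero
    ENNReal.one_ne_top).trans_le ?_
  rw [measure_sdiff (Metric.self_subset_thickening hδ C) hC.nullMeasurableSet (measure_ne_top _ _)]
  simpa [add_comm] using hδε.le

/-- `E` can be approximated in `L¹(P)` by Lipschitz cylinder functions. -/
def IsCylinderApproximable (P : Measure (ι → V)) (E : Set (ι → V)) : Prop :=
  ∀ ε : ℝ≥0∞, ε ≠ 0 → ∃ F L G, CylinderLipschitz F L G ∧ eLpNorm (E.indicator 1 - G) 1 P ≤ ε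

variable {P : Measure (ι → V)} {A B E : Set (ι → V)}

theorem isCylinderApproximable_empty : IsCylinderApproximable P ∅ := fun ε _ =>
  ⟨∅, 0, 0, fun _ _ => by simp, by simp⟩

theorem IsCylinderApproximable.compl (hE : IsCylinderApproximable P E) :
    IsCylinderApproximable P Eᶜ := fun ε hε => by
  obtain ⟨F, L, G, hG, hEG⟩ := hE ε hε
  refine ⟨F, L, 1 - G, hG.const_sub 1, ?_⟩
  rwa [Set.indicator_compl, sub_sub_sub_cancel_left, eLpNorm_sub_comm]

theorem abs_indicator_union_sub_max_le {α : Type*} (A B : Set α) (z : α) (a b : ℝ) :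
    |(A ∪ B).indicator 1 z - max a b| ≤ |A.indicator 1 z - a| + |B.indicator 1 z - b| := by
  have hmax : (A ∪ B).indicator (1 : α → ℝ) z = max (A.indicator 1 z) (B.indicator 1 z) := by
    by_cases hA : z ∈ A <;> by_cases hB : z ∈ B <;> simp [hA, hB]
  rw [hmax]
  exact (abs_max_sub_max_le_max _ _ _ _).trans
    (max_le (le_add_of_nonneg_right (abs_nonneg _)) (le_add_of_nonneg_left (abs_nonneg _)))

variable [BorelSpace V]

theorem isCylinderApproximable_eval_preimage [IsFiniteMeasure P] (i : ι) {C : Set V}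
    (hC : IsClosed C) :
    IsCylinderApproximable P (Function.eval i ⁻¹' C) := fun ε hε => by
  have hi : Measurable (Function.eval i : (ι → V) → V) := measurable_pi_apply i
  obtain ⟨L, G, hG, hCG⟩ := exists_lipschitzWith_eLpNorm_indicator_sub_le (P.map (Function.eval i))
    hC hε
  refine ⟨{i}, L, fun z => G (z i), fun z z' => ?_, ?_⟩
  · rw [Finset.sum_singleton]
    exact hG.dist_le_mul (z i) (z' i)
  · have hm : AEStronglyMeasurable (C.indicator 1 - G) (P.map (Function.eval i)) :=
      (aestronglyMeasurable_one.indicator hC.measurableSet).sub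
        hG.continuous.aestronglyMeasurable
    exact (eLpNorm_map_measure hm hi.aemeasurable).symm.trans_le hCG

theorem generateFrom_isCylinderApproximable [IsFiniteMeasure P] :
    MeasurableSpace.generateFrom {E | MeasurableSet E ∧ IsCylinderApproximable P E} =
      MeasurableSpace.pi := by
  refine le_antisymm (MeasurableSpace.generateFrom_le fun _ hE => hE.1) (iSup_le fun i => ?_)
  rw [← measurable_iff_comap_le]
  exact @measurable_of_isClosed _ _ _ _ _ (MeasurableSpace.generateFrom _) _ fun C hC =>
    MeasurableSpace.measurableSet_generateFrom
      ⟨measurable_pi_apply i hC.measurableSet, isCylinderApproximable_eval_preimage i hC⟩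

variable [SecondCountableTopology V] [Countable ι]

theorem aestronglyMeasurable_indicator_sub (hE : MeasurableSet E) {F : Finset ι} {L : ℝ≥0}
    {G : (ι → V) → ℝ} (hG : CylinderLipschitz F L G) :
    AEStronglyMeasurable (E.indicator 1 - G) P :=
  (aestronglyMeasurable_one.indicator hE).sub hG.continuous.aestronglyMeasurable

theorem IsCylinderApproximable.union (hAm : MeasurableSet A) (hBm : MeasurableSet B)
    (hA : IsCylinderApproximable P A) (hB : IsCylinderApproximable P B) :
    IsCylinderApproximable P (A ∪ B) := by
  classical
  intro ε hε
  obtain ⟨F, L, G, hG, hAG⟩ := hA (ε / 2) (ENNReal.half_pos hε).ne'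
  obtain ⟨F', L', G', hG', hBG'⟩ := hB (ε / 2) (ENNReal.half_pos hε).ne'
  refine ⟨F ∪ F', max L L', fun z => max (G z) (G' z), hG.max hG', ?_⟩
  let a : (ι → V) → ℝ := A.indicator 1 - G
  let b : (ι → V) → ℝ := B.indicator 1 - G'
  calc eLpNorm ((A ∪ B).indicator 1 - fun z => max (G z) (G' z)) 1 P
      ≤ eLpNorm (fun z => ‖a z‖ + ‖b z‖) 1 P :=
        eLpNorm_mono_real fun z => abs_indicator_union_sub_max_le A B z _ _
    _ ≤ eLpNorm (fun z => ‖a z‖) 1 P + eLpNorm (fun z => ‖b z‖) 1 P :=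
        eLpNorm_add_le (aestronglyMeasurable_indicator_sub hAm hG).norm
          (aestronglyMeasurable_indicator_sub hBm hG').norm le_rfl
    _ = eLpNorm a 1 P + eLpNorm b 1 P := by rw [eLpNorm_norm, eLpNorm_norm]
    _ ≤ ε := (add_le_add hAG hBG').trans_eq (ENNReal.add_halves ε)

theorem isSetAlgebra_isCylinderApproximable :
    IsSetAlgebra {E | MeasurableSet E ∧ IsCylinderApproximable P E} where
  empty_mem := ⟨.empty, isCylinderApproximable_empty⟩
  compl_mem _ hE := ⟨hE.1.compl, hE.2.compl⟩
  union_mem _ _ hA hB := ⟨hA.1.union hB.1, hA.2.union hA.1 hB.1 hB.2⟩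

variable [IsFiniteMeasure P]

theorem isCylinderApproximable_of_measurableSet (hE : MeasurableSet E) :
    IsCylinderApproximable P E := fun ε hε => by
  obtain ⟨r, hr, hrε⟩ := ENNReal.lt_iff_exists_nnreal_btwn.1 (ENNReal.half_pos hε)
  obtain ⟨A, ⟨hAm, hA⟩, hEA⟩ := (Measure.MeasureDense.of_generateFrom_isSetAlgebra_finite P
    (isSetAlgebra_isCylinderApproximable (P := P)) generateFrom_isCylinderApproximable.symm).approx
    E hE
    (measure_ne_top P E) r (by exact_mod_cast hr)
  obtain ⟨F, L, G, hG, hAG⟩ := hA (ε / 2) (ENNReal.half_pos hε).ne'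
  have hsymm : eLpNorm (E.indicator (1 : (ι → V) → ℝ) - A.indicator 1) 1 P ≤ ε / 2 := by
    refine (eLpNorm_indicator_sub_indicator E A _).trans_le ?_
    refine (eLpNorm_indicator_const (c := (1 : ℝ)) (hE.symmDiff hAm) one_ne_zero
      ENNReal.one_ne_top).trans_le ?_
    simpa using hEA.le.trans (ENNReal.ofReal_coe_nnreal.trans_le hrε.le)
  refine ⟨F, L, G, hG, ?_⟩
  calc eLpNorm (E.indicator 1 - G) 1 P
      = eLpNorm ((E.indicator 1 - A.indicator 1) + (A.indicator 1 - G)) 1 P := by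
        rw [sub_add_sub_cancel]
    _ ≤ ε / 2 + ε / 2 := (eLpNorm_add_le
        ((aestronglyMeasurable_one.indicator hE).sub (aestronglyMeasurable_one.indicator hAm))
        (aestronglyMeasurable_indicator_sub hAm hG) le_rfl).trans (add_le_add hsymm hAG)
    _ = ε := ENNReal.add_halves ε

theorem exists_forall_cylinderLipschitz_comp {X κ : Type*} [Finite κ] [MeasurableSpace X]
    {μ : Measure X} [IsFiniteMeasure μ] {T : X → ι → V} (hT : Measurable T)
    (hgen : ‹MeasurableSpace X› ≤ MeasurableSpace.pi.comap T) {E : κ → Set X}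
    (hE : ∀ i, MeasurableSet (E i)) {ε : ℝ≥0∞} (hε : ε ≠ 0) :
    ∃ (F : Finset ι) (L : ℝ≥0) (G : κ → (ι → V) → ℝ), ∀ i,
      CylinderLipschitz F L (G i) ∧ eLpNorm ((E i).indicator 1 - G i ∘ T) 1 μ ≤ ε := by
  classical
  have := Fintype.ofFinite κ
  choose E' hE' hEE' using fun i => hgen _ (hE i)
  choose F L G hG hEG using fun i => isCylinderApproximable_of_measurableSet
    (P := μ.map T) (hE' i) ε hε
  refine ⟨Finset.univ.sup F, Finset.univ.sup L, G, fun i =>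
    ⟨(hG i).mono (Finset.le_sup (Finset.mem_univ i)) (Finset.le_sup (Finset.mem_univ i)), ?_⟩⟩
  rw [← hEE' i]
  exact (eLpNorm_map_measure (aestronglyMeasurable_indicator_sub (hE' i) (hG i))
    hT.aemeasurable).symm.trans_le (hEG i)

end Cylinder

/-! ## Translates of a function -/

section Translates

open scoped NNReal

/-- The orbit map `x ↦ (g ↦ ζ (g⁻¹ x))` of a function `ζ`: it intertwines the action on `X` with the
left shift of functions on `Γ`. -/
def translates (Γ : Type*) {X V : Type*} [Group Γ] [MulAction Γ X] (ζ : X → V) (x : X) : Γ → V :=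
  fun g => ζ (g⁻¹ • x)

/-- The convolution `f ⋆ w = ∑ g, f(g) w(g⁻¹ ·)` of a finitely supported function on the group with
a function on the space, that is, the image of `w` under `ρ(f)`. -/
noncomputable def translateSum {Γ X : Type*} [Group Γ] [MulAction Γ X] (f : Γ →₀ ℂ) (w : X → ℂ)
    (x : X) : ℂ :=
  ∑ g ∈ f.support, f g * w (g⁻¹ • x)

variable {Γ X : Type*} [Group Γ] [MulAction Γ X]

theorem translateSum_sub (f : Γ →₀ ℂ) (w w' : X → ℂ) :
    translateSum f (w - w') = translateSum f w - translateSum f w' := by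
  ext x
  simp only [translateSum, Pi.sub_apply, mul_sub, Finset.sum_sub_distrib]

variable [MeasurableSpace X]

/-- `ζ` is a singular vector of the Koopman representation, phrased for functions rather than for
elements of `L²` so that it can be transported along a factor map. -/
def IsSingularFunction (Γ : Type*) {X : Type*} [Group Γ] [MulAction Γ X] [MeasurableSpace X]
    (μ : Measure X) (ζ : X → ℂ) : Prop :=
  ∀ ε > 0, ∃ f : Γ →₀ ℂ, eLpNorm (translateSum f ζ - ζ) 2 μ < ENNReal.ofReal ε ∧
    ∑ g ∈ f.support, ‖f g‖ ^ 2 < ε ^ 2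

variable [MeasurableConstSMul Γ X]

theorem measurable_translates {V : Type*} [MeasurableSpace V] {ζ : X → V} (hζ : Measurable ζ) :
    Measurable (translates Γ ζ) :=
  measurable_pi_lambda _ fun g => hζ.comp (measurable_const_smul g⁻¹)

theorem aestronglyMeasurable_comp_smul {V : Type*} [TopologicalSpace V] {μ : Measure X}
    [SMulInvariantMeasure Γ X μ] {w : X → V} (hw : AEStronglyMeasurable w μ) (g : Γ) :
    AEStronglyMeasurable (fun x => w (g • x)) μ :=
  hw.comp_measurePreserving (measurePreserving_smul g μ)

variable {μ : Measure X} [SMulInvariantMeasure Γ X μ] {p : ℝ≥0∞}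

theorem eLpNorm_translateSum_le (hp : 1 ≤ p) (f : Γ →₀ ℂ) {w : X → ℂ}
    (hw : AEStronglyMeasurable w μ) :
    eLpNorm (translateSum f w) p μ ≤ (∑ g ∈ f.support, ‖f g‖ₑ) * eLpNorm w p μ := by
  have hsum : translateSum f w = ∑ g ∈ f.support, f g • fun x => w (g⁻¹ • x) := by
    ext x
    simp [translateSum]
  rw [hsum, Finset.sum_mul]
  refine (eLpNorm_sum_le
    (fun g _ => (aestronglyMeasurable_comp_smul hw g⁻¹).const_smul _) hp).trans_eq ?_
  refine Finset.sum_congr rfl fun g _ => ?_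
  rw [eLpNorm_const_smul]
  exact congrArg _ (eLpNorm_comp_measurePreserving hw (measurePreserving_smul g⁻¹ μ))

theorem aestronglyMeasurable_translateSum (f : Γ →₀ ℂ) {w : X → ℂ}
    (hw : AEStronglyMeasurable w μ) : AEStronglyMeasurable (translateSum f w) μ :=
  Finset.aestronglyMeasurable_fun_sum _ fun g _ =>
    (aestronglyMeasurable_comp_smul hw g⁻¹).const_mul (f g)

theorem eLpNorm_translateSum_sub_le (hp : 1 ≤ p) (f : Γ →₀ ℂ) {ζ w : X → ℂ}
    (hζ : AEStronglyMeasurable ζ μ) (hw : AEStronglyMeasurable w μ) :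
    eLpNorm (translateSum f w - w) p μ ≤ eLpNorm (translateSum f ζ - ζ) p μ +
      ((∑ g ∈ f.support, ‖f g‖ₑ) + 1) * eLpNorm (ζ - w) p μ := by
  have hsub := hζ.sub hw
  calc eLpNorm (translateSum f w - w) p μ
      = eLpNorm (translateSum f ζ - ζ - (translateSum f (ζ - w) - (ζ - w))) p μ := by
        rw [translateSum_sub]
        congr 1
        abel
    _ ≤ eLpNorm (translateSum f ζ - ζ) p μ + eLpNorm (translateSum f (ζ - w) - (ζ - w)) p μ :=
        eLpNorm_sub_le ((aestronglyMeasurable_translateSum f hζ).sub hζ)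
          ((aestronglyMeasurable_translateSum f hsub).sub hsub) hp
    _ ≤ eLpNorm (translateSum f ζ - ζ) p μ +
          (eLpNorm (translateSum f (ζ - w)) p μ + eLpNorm (ζ - w) p μ) := by
        gcongr
        exact eLpNorm_sub_le (aestronglyMeasurable_translateSum f hsub) hsub hp
    _ ≤ _ := by
        rw [add_mul, one_mul]
        gcongr
        exact eLpNorm_translateSum_le hp f hsub

theorem eLpNorm_comp_translates_sub_le {V : Type*} [NormedAddCommGroup V] {F : Finset Γ}
    {L : ℝ≥0} {G : (Γ → V) → ℝ} (hG : CylinderLipschitz F L G) (hp : 1 ≤ p) {ζ w : X → V}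
    (hζ : AEStronglyMeasurable ζ μ) (hw : AEStronglyMeasurable w μ) :
    eLpNorm (G ∘ translates Γ ζ - G ∘ translates Γ w) p μ ≤
      L * F.card * eLpNorm (ζ - w) p μ := by
  have hsub (g : Γ) : AEStronglyMeasurable (fun x => ‖(ζ - w) (g⁻¹ • x)‖) μ :=
    (aestronglyMeasurable_comp_smul (hζ.sub hw) g⁻¹).norm
  calc eLpNorm (G ∘ translates Γ ζ - G ∘ translates Γ w) p μ
      ≤ L * eLpNorm (∑ g ∈ F, fun x => ‖(ζ - w) (g⁻¹ • x)‖) p μ := by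
        refine eLpNorm_le_nnreal_smul_eLpNorm_of_ae_le_mul (.of_forall fun x => ?_) p
        rw [← NNReal.coe_le_coe, NNReal.coe_mul, coe_nnnorm, coe_nnnorm, Finset.sum_apply,
          Real.norm_of_nonneg (Finset.sum_nonneg fun _ _ => norm_nonneg _)]
        simpa only [translates, dist_eq_norm, Pi.sub_apply, Function.comp_apply, Real.norm_eq_abs]
          using hG (translates Γ ζ x) (translates Γ w x)
    _ ≤ L * ∑ _g ∈ F, eLpNorm (ζ - w) p μ := by
        gcongr
        refine (eLpNorm_sum_le (fun g _ => hsub g) hp).trans_eq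
          (Finset.sum_congr rfl fun g _ => ?_)
        rw [eLpNorm_norm]
        exact eLpNorm_comp_measurePreserving (hζ.sub hw) (measurePreserving_smul g⁻¹ μ)
    _ = L * F.card * eLpNorm (ζ - w) p μ := by
        rw [Finset.sum_const, nsmul_eq_mul, mul_assoc]

end Translates

theorem exists_refinement {X V : Type*} [MeasurableSpace X] [NormedAddCommGroup V]
    {μ : Measure X} {p ε : ℝ≥0∞} {ζ : X → V} (hζ : MemLp ζ p μ) (hp : p ≠ ∞) {k : ℕ}
    {α : X → Fin k} (hα : Measurable α) (hε : ε ≠ 0) :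
    ∃ (m : ℕ) (β : X → Fin m) (pr : Fin m → Fin k) (v : Fin m → V), Measurable β ∧
      (∀ x, pr (β x) = α x) ∧ eLpNorm (ζ - v ∘ β) p μ < ε := by
  obtain ⟨s, hs, -⟩ := hζ.exists_simpleFunc_eLpNorm_sub_lt hp hε
  have : Fintype s.range := inferInstance
  borelize V
  let e : Fin k × s.range ≃ Fin (Fintype.card (Fin k × s.range)) := Fintype.equivFin _
  refine ⟨_, fun x => e (α x, ⟨s x, s.mem_range_self x⟩), fun b => (e.symm b).1,
    fun b => (e.symm b).2, ?_, fun x => by simp, ?_⟩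
  · exact (Measurable.of_discrete (f := e)).comp (hα.prodMk s.measurable.subtype_mk)
  · simpa only [Function.comp_def, e.symm_apply_apply] using hs

/-! ## Statistics of microstates -/

theorem eventually_nhdsGT_lt {α γ : Type*} [TopologicalSpace α] [Preorder α] [TopologicalSpace γ]
    [LinearOrder γ] [OrderTopology γ] {f : α → γ} {x : α} (hf : ContinuousAt f x) {t : γ}
    (h : f x < t) : ∀ᶠ y in 𝓝[>] x, f y < t :=
  (hf.tendsto.eventually_lt_const h).filter_mono nhdsWithin_le_nhds

theorem sum_comp_eq_sum_unifMeas_mul {d : ℕ} {A : Type*} [Fintype A] (φ : Fin d → A)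
    (H : A → ℝ) : ∑ j, H (φ j) = (∑ a, unifMeas d (φ ⁻¹' {a}) * H a) * d := by
  classical
  rcases eq_or_ne d 0 with rfl | hd
  · simp
  rw [← Finset.sum_fiberwise' Finset.univ φ H, Finset.sum_mul]
  refine Finset.sum_congr rfl fun a _ => ?_
  rw [Finset.sum_const, nsmul_eq_mul, unifMeas, mul_right_comm,
    div_mul_cancel₀ _ (Nat.cast_ne_zero.2 hd), Set.ncard_eq_toFinset_card']
  congr 3
  ext j
  simp

theorem integral_comp_eq_sum_measureReal_mul {X A : Type*} [MeasurableSpace X] {μ : Measure X}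
    [IsFiniteMeasure μ] [Fintype A] [MeasurableSpace A] [MeasurableSingletonClass A] {T : X → A}
    (hT : Measurable T) (H : A → ℝ) :
    ∫ x, H (T x) ∂μ = ∑ a, μ.real (T ⁻¹' {a}) * H a := by
  have hH : Measurable H := measurable_of_finite H
  rw [← integral_map hT.aemeasurable hH.aestronglyMeasurable, integral_fintype .of_finite]
  refine Finset.sum_congr rfl fun a _ => ?_
  rw [map_measureReal_apply hT (measurableSet_singleton a), smul_eq_mul]

theorem integral_norm_pow_lt_of_eLpNorm_lt {X V : Type*} [MeasurableSpace X]
    [NormedAddCommGroup V] {μ : Measure X} {p : ℕ} (hp : p ≠ 0) {w : X → V} (hw : MemLp w p μ)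
    {t : ℝ} (h : eLpNorm w p μ < ENNReal.ofReal t) : ∫ x, ‖w x‖ ^ p ∂μ < t ^ p := by
  have ht : 0 < t := ENNReal.ofReal_pos.1 (pos_of_gt h)
  have hI : 0 ≤ ∫ x, ‖w x‖ ^ p ∂μ := integral_nonneg fun x => by positivity
  rw [hw.eLpNorm_eq_integral_rpow_norm (Nat.cast_ne_zero.2 hp) (ENNReal.natCast_ne_top p),
    ENNReal.ofReal_lt_ofReal_iff ht] at h
  simp only [ENNReal.toReal_natCast, Real.rpow_natCast] at h
  rwa [Real.rpow_inv_lt_iff_of_pos hI ht.le (by positivity), Real.rpow_natCast] at h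

namespace SoficEntropy

variable {Γ X : Type*} [Group Γ] [MulAction Γ X] {m : ℕ} {β : X → Fin m} {F : Finset Γ}
  {hF : (1 : Γ) ∈ F}

section

variable {d : ℕ} {σ : Γ → Equiv.Perm (Fin d)} {δ : ℝ}

theorem card_filter_ne_le_of_mem_AP [MeasurableSpace X] {μ : Measure X}
    {φ : Fin d → (F → Fin m)} (hφ : φ ∈ AP μ β F hF δ σ) :
    (Finset.card {j | (fun g : F => φ ((σ g)⁻¹ j) ⟨1, hF⟩) ≠ φ j} : ℝ) ≤ F.card * (δ * d) := by
  classical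
  rcases eq_or_ne d 0 with rfl | hd
  · simp
  have hunion : ({j | (fun g : F => φ ((σ g)⁻¹ j) ⟨1, hF⟩) ≠ φ j} : Finset (Fin d)) ⊆
      Finset.univ.biUnion fun g : F => {j | φ j g ≠ φ ((σ g)⁻¹ j) ⟨1, hF⟩} := fun j => by
    simp [funext_iff, eq_comm]
  have hcard (g : F) :
      (Finset.card {j | φ j g ≠ φ ((σ g)⁻¹ j) ⟨1, hF⟩} : ℝ) ≤ δ * d := by
    have hg := (hφ.2 g).le
    rwa [unifMeas, div_le_iff₀ (by positivity), Set.ncard_eq_toFinset_card',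
      Set.toFinset_ofPred] at hg
  calc (Finset.card {j | (fun g : F => φ ((σ g)⁻¹ j) ⟨1, hF⟩) ≠ φ j} : ℝ)
      ≤ ∑ g : F, (Finset.card {j | φ j g ≠ φ ((σ g)⁻¹ j) ⟨1, hF⟩} : ℝ) := by
        exact_mod_cast (Finset.card_le_card hunion).trans Finset.card_biUnion_le
    _ ≤ ∑ _g : F, δ * d := Finset.sum_le_sum fun g _ => hcard g
    _ = F.card * (δ * d) := by
        rw [Finset.sum_const, Finset.card_univ, Fintype.card_coe, nsmul_eq_mul]

end

variable [MeasurableSpace X] [MeasurableConstSMul Γ X] {μ : Measure X} [IsFiniteMeasure μ]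

theorem measurable_itinerary (hβ : Measurable β) (F : Finset Γ) : Measurable (itinerary β F) :=
  measurable_pi_lambda _ fun g => hβ.comp (measurable_const_smul (g : Γ)⁻¹)

theorem sum_le_integral_add_mul_of_mem_AP {d : ℕ} {σ : Γ → Equiv.Perm (Fin d)} {δ : ℝ}
    (hβ : Measurable β) {φ : Fin d → (F → Fin m)} (hφ : φ ∈ AP μ β F hF δ σ)
    {H : (F → Fin m) → ℝ} {C : ℝ} (hC : ∀ a, |H a| ≤ C) :
    ∑ j, H (φ j) ≤ (∫ x, H (itinerary β F x) ∂μ + C * δ) * d := by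
  classical
  rcases eq_or_ne d 0 with rfl | hd
  · simp
  have hC₀ : 0 ≤ C := (abs_nonneg _).trans (hC (φ ⟨0, hd.bot_lt⟩))
  rw [sum_comp_eq_sum_unifMeas_mul φ H]
  gcongr
  rw [integral_comp_eq_sum_measureReal_mul (measurable_itinerary hβ F), ← sub_le_iff_le_add',
    ← Finset.sum_sub_distrib]
  calc ∑ a, (unifMeas d (φ ⁻¹' {a}) * H a - μ.real (itinerary β F ⁻¹' {a}) * H a)
      ≤ ∑ a, C * |unifMeas d (φ ⁻¹' {a}) - μ.real (itinerary β F ⁻¹' {a})| := by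
        refine Finset.sum_le_sum fun a _ => ?_
        rw [← sub_mul, mul_comm]
        refine (le_abs_self _).trans ?_
        rw [abs_mul]
        gcongr
        exact hC a
    _ ≤ C * δ := by
        rw [← Finset.mul_sum]
        exact mul_le_mul_of_nonneg_left hφ.1.le hC₀

theorem eventually_sum_le_of_mem_AP (hβ : Measurable β) (hF : (1 : Γ) ∈ F)
    (H : Fin m → (F → Fin m) → ℝ) {I : ℝ} (hI : ∫ x, H (β x) (itinerary β F x) ∂μ < I) :
    ∀ᶠ δ in 𝓝[>] (0 : ℝ), ∀ (d : ℕ) (σ : Γ → Equiv.Perm (Fin d)), ∀ φ ∈ AP μ β F hF δ σ,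
      ∑ j, H (φ j ⟨1, hF⟩) (fun g => φ ((σ g)⁻¹ j) ⟨1, hF⟩) ≤ I * d := by
  classical
  obtain ⟨C, hC⟩ : ∃ C, ∀ q : Fin m × (F → Fin m), |H q.1 q.2| ≤ C :=
    (Set.finite_range _).bddAbove.imp fun C hC q => hC ⟨q, rfl⟩
  let J := ∫ x, H (β x) (itinerary β F x) ∂μ
  have hJ : J = ∫ x, H (itinerary β F x ⟨1, hF⟩) (itinerary β F x) ∂μ := by
    simp only [J, itinerary, inv_one, one_smul]
  have hsmall : ∀ᶠ δ in 𝓝[>] (0 : ℝ), J + C * δ + 2 * C * (F.card * δ) < I := by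
    have hcont : Continuous fun δ : ℝ => J + C * δ + 2 * C * (F.card * δ) := by fun_prop
    exact eventually_nhdsGT_lt hcont.continuousAt (by simpa using hI)
  filter_upwards [hsmall] with δ hδ d σ φ hφ
  rcases eq_or_ne d 0 with rfl | hd
  · simp
  have hC₀ : 0 ≤ C := (abs_nonneg _).trans (hC (φ ⟨0, hd.bot_lt⟩ ⟨1, hF⟩, φ ⟨0, hd.bot_lt⟩))
  have hpoint (j : Fin d) : H (φ j ⟨1, hF⟩) (fun g => φ ((σ g)⁻¹ j) ⟨1, hF⟩) ≤
      H (φ j ⟨1, hF⟩) (φ j) +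
        if (fun g : F => φ ((σ g)⁻¹ j) ⟨1, hF⟩) ≠ φ j then 2 * C else 0 := by
    split_ifs with hj
    · linarith [abs_le.1 (hC (φ j ⟨1, hF⟩, φ j)),
        abs_le.1 (hC (φ j ⟨1, hF⟩, fun g => φ ((σ g)⁻¹ j) ⟨1, hF⟩))]
    · rw [not_ne_iff.1 hj, add_zero]
  calc ∑ j, H (φ j ⟨1, hF⟩) (fun g => φ ((σ g)⁻¹ j) ⟨1, hF⟩)
      ≤ ∑ j, H (φ j ⟨1, hF⟩) (φ j) +
          2 * C * Finset.card {j | (fun g : F => φ ((σ g)⁻¹ j) ⟨1, hF⟩) ≠ φ j} := by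
        refine (Finset.sum_le_sum fun j _ => hpoint j).trans_eq ?_
        rw [Finset.sum_add_distrib, ← Finset.sum_filter, Finset.sum_const, nsmul_eq_mul,
          mul_comm (2 * C)]
    _ ≤ (J + C * δ) * d + 2 * C * (F.card * (δ * d)) := by
        gcongr
        · rw [hJ]
          exact sum_le_integral_add_mul_of_mem_AP (H := fun a => H (a ⟨1, hF⟩) a) hβ hφ
            fun a => hC (_, a)
        · exact card_filter_ne_le_of_mem_AP hφ
    _ = (J + C * δ + 2 * C * (F.card * δ)) * d := by ring
    _ ≤ I * d := by gcongr

theorem eventually_sum_norm_pow_le_of_mem_AP {V : Type*} [NormedAddCommGroup V]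
    (hβ : Measurable β) (hF : (1 : Γ) ∈ F) (u : Fin m → (F → Fin m) → V) {p : ℕ} (hp : p ≠ 0)
    {t : ℝ} (ht : eLpNorm (fun x => u (β x) (itinerary β F x)) p μ < ENNReal.ofReal t) :
    ∀ᶠ δ in 𝓝[>] (0 : ℝ), ∀ (d : ℕ) (σ : Γ → Equiv.Perm (Fin d)), ∀ φ ∈ AP μ β F hF δ σ,
      ∑ j, ‖u (φ j ⟨1, hF⟩) (fun g => φ ((σ g)⁻¹ j) ⟨1, hF⟩)‖ ^ p ≤ t ^ p * d := by
  have hmeas : Measurable fun x => (β x, itinerary β F x) :=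
    hβ.prodMk (measurable_itinerary hβ F)
  have hmem : MemLp (fun x => u (β x) (itinerary β F x)) p μ := by
    have : IsFiniteMeasure (μ.map fun x => (β x, itinerary β F x)) := inferInstance
    exact MemLp.comp_of_map (g := fun q : Fin m × (F → Fin m) => u q.1 q.2) MemLp.of_discrete
      hmeas.aemeasurable
  exact eventually_sum_le_of_mem_AP hβ hF (fun b a => ‖u b a‖ ^ p)
    (integral_norm_pow_lt_of_eLpNorm_lt hp hmem ht)

end SoficEntropy

/-! ## Counting models -/

section Models

open scoped NNReal

/-- The pair of the labelling `a` of `{1, …, d}` and the vector `c ∈ ℂ^d` is a finite model of a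
labelled space with a function `ζ`: `c` has size at most `R` and is almost fixed by `T` in the
normalized `ℓ²` norm, and for every label `i` the indicator function of `{a = i}` is almost the
function `G i` of the translates of `c`, in the normalized `ℓ¹` norm. -/
structure IsModel {Γ A : Type*} {d : ℕ} (σ : Γ → Equiv.Perm (Fin d))
    (T : EuclideanSpace ℂ (Fin d) →ₗ[ℂ] EuclideanSpace ℂ (Fin d)) (G : A → (Γ → ℂ) → ℝ)
    (R ε κ : ℝ) (a : Fin d → A) (c : EuclideanSpace ℂ (Fin d)) : Prop where
  norm_le : ‖c‖ ≤ R * √d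
  norm_sub_apply_le : ‖c - T c‖ ≤ ε * √d
  sum_abs_le : ∀ i, ∑ j, |(a ⁻¹' {i}).indicator 1 j - G i fun g => c ((σ g)⁻¹ j)| ≤ κ * d

theorem hammingDist_le_sum_abs {ι A : Type*} [Fintype ι] [Fintype A] [DecidableEq A]
    (a a' : ι → A) :
    (hammingDist a a' : ℝ) ≤
      ∑ i, ∑ j, |(a ⁻¹' {i}).indicator (1 : ι → ℝ) j - (a' ⁻¹' {i}).indicator 1 j| := by
  rw [Finset.sum_comm, hammingDist, ← Finset.sum_boole]
  refine Finset.sum_le_sum fun j _ => ?_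
  have hnonneg (i : A) :
      0 ≤ |(a ⁻¹' {i}).indicator (1 : ι → ℝ) j - (a' ⁻¹' {i}).indicator 1 j| := abs_nonneg _
  split_ifs with h
  · refine le_of_eq_of_le ?_ (Finset.single_le_sum (fun i _ => hnonneg i) (Finset.mem_univ (a j)))
    simp [Ne.symm h]
  · exact Finset.sum_nonneg fun i _ => hnonneg i

theorem sum_norm_le_sqrt_mul_norm {𝕜 ι : Type*} [RCLike 𝕜] [Fintype ι] (c : EuclideanSpace 𝕜 ι) :
    ∑ j, ‖c j‖ ≤ √(Fintype.card ι) * ‖c‖ := by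
  refine (sq_le_sq₀ (by positivity) (by positivity)).1 ?_
  rw [mul_pow, Real.sq_sqrt (Nat.cast_nonneg _), EuclideanSpace.norm_sq_eq]
  exact sq_sum_le_card_mul_sum_sq

variable {Γ A : Type*} {d : ℕ} {σ : Γ → Equiv.Perm (Fin d)}
  {T : EuclideanSpace ℂ (Fin d) →ₗ[ℂ] EuclideanSpace ℂ (Fin d)} {F : Finset Γ} {L : ℝ≥0}

theorem CylinderLipschitz.sum_abs_sub_le {G : (Γ → ℂ) → ℝ} (hG : CylinderLipschitz F L G)
    (c c' : EuclideanSpace ℂ (Fin d)) :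
    ∑ j, |G (fun g => c ((σ g)⁻¹ j)) - G fun g => c' ((σ g)⁻¹ j)| ≤
      L * F.card * (√d * ‖c - c'‖) := by
  calc ∑ j, |G (fun g => c ((σ g)⁻¹ j)) - G fun g => c' ((σ g)⁻¹ j)|
      ≤ ∑ j, L * ∑ g ∈ F, dist (c ((σ g)⁻¹ j)) (c' ((σ g)⁻¹ j)) :=
        Finset.sum_le_sum fun j _ => hG _ _
    _ = L * ∑ g ∈ F, ∑ j, ‖(c - c') ((σ g)⁻¹ j)‖ := by
        rw [← Finset.mul_sum, Finset.sum_comm]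
        simp only [dist_eq_norm, PiLp.sub_apply]
    _ = L * ∑ _g ∈ F, ∑ j, ‖(c - c') j‖ := by
        congr 1
        exact Finset.sum_congr rfl fun g _ => Equiv.sum_comp (σ g)⁻¹ fun j => ‖(c - c') j‖
    _ = L * F.card * ∑ j, ‖(c - c') j‖ := by
        rw [Finset.sum_const, nsmul_eq_mul, mul_assoc]
    _ ≤ L * F.card * (√d * ‖c - c'‖) := by
        gcongr
        simpa only [Fintype.card_fin] using sum_norm_le_sqrt_mul_norm (c - c')

variable {G : A → (Γ → ℂ) → ℝ} {R ε κ r : ℝ}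

theorem IsModel.hammingDist_le [Fintype A] [DecidableEq A] (hG : ∀ i, CylinderLipschitz F L (G i))
    {a a' : Fin d → A} {c c' : EuclideanSpace ℂ (Fin d)} (ha : IsModel σ T G R ε κ a c)
    (ha' : IsModel σ T G R ε κ a' c') (hc : ‖c - c'‖ ≤ r * √d) :
    (hammingDist a a' : ℝ) ≤ Fintype.card A * (2 * κ + L * F.card * r) * d := by
  have hlabel (i : A) :
      ∑ j, |(a ⁻¹' {i}).indicator (1 : Fin d → ℝ) j - (a' ⁻¹' {i}).indicator 1 j| ≤
        (2 * κ + L * F.card * r) * d := by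
    let p (j : Fin d) : ℝ := G i fun g => c ((σ g)⁻¹ j)
    let q (j : Fin d) : ℝ := G i fun g => c' ((σ g)⁻¹ j)
    calc ∑ j, |(a ⁻¹' {i}).indicator (1 : Fin d → ℝ) j - (a' ⁻¹' {i}).indicator 1 j|
        ≤ ∑ j, (|(a ⁻¹' {i}).indicator 1 j - p j| + |p j - q j| +
            |(a' ⁻¹' {i}).indicator 1 j - q j|) :=
          Finset.sum_le_sum fun j _ => by
            rw [abs_sub_comm ((a' ⁻¹' {i}).indicator 1 j) (q j)]
            exact (abs_sub_le _ (q j) _).trans (add_le_add_left (abs_sub_le _ (p j) _) _)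
      _ ≤ κ * d + L * F.card * (√d * (r * √d)) + κ * d := by
          rw [Finset.sum_add_distrib, Finset.sum_add_distrib]
          gcongr
          · exact ha.sum_abs_le i
          · exact ((hG i).sum_abs_sub_le c c').trans (by gcongr)
          · exact ha'.sum_abs_le i
      _ = (2 * κ + L * F.card * r) * d := by
          linear_combination L * F.card * r * Real.mul_self_sqrt (Nat.cast_nonneg (α := ℝ) d)
  calc (hammingDist a a' : ℝ)
      ≤ ∑ _i : A, (2 * κ + L * F.card * r) * d :=
        (hammingDist_le_sum_abs a a').trans (Finset.sum_le_sum fun i _ => hlabel i)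
    _ = Fintype.card A * (2 * κ + L * F.card * r) * d := by
        rw [Finset.sum_const, Finset.card_univ, nsmul_eq_mul, ← mul_assoc]

theorem card_le_rpow_of_isModel (hd : 0 < d) (hr : 0 < r) (hR : 0 < R) (hε : ε ≤ r / 8)
    (hT : ∑ k, ‖T (EuclideanSpace.basisFun _ ℂ k)‖ ^ 2 ≤ ε ^ 2 * d) {s : Finset (Fin d → A)}
    {c : (Fin d → A) → EuclideanSpace ℂ (Fin d)} (hc : ∀ a ∈ s, IsModel σ T G R ε κ a (c a))
    (hsep : (s : Set (Fin d → A)).Pairwise fun a b => r * √d ≤ dist (c a) (c b)) :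
    (s.card : ℝ) ≤ (2 + 4 * R / r) ^ (2 * (ε / (r / (8 * R))) ^ 2 * d) := by
  have hd' : (0 : ℝ) < √d := Real.sqrt_pos.2 (Nat.cast_pos.2 hd)
  have hδR : r / (8 * R) * (R * √d) = r / 8 * √d := by field_simp
  have hratio : 4 * (R * √d) / (r * √d) = 4 * R / r := by field_simp
  have hcard := card_le_rpow_of_norm_sub_apply_le (EuclideanSpace.basisFun (Fin d) ℂ) T s c
    (δ := r / (8 * R)) (by positivity) (by positivity) (mul_pos hr hd') (ε := ε * √d)
    (by rw [hδR]; nlinarith) (fun a ha => (hc a ha).norm_le)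
    (fun a ha => (hc a ha).norm_sub_apply_le) hsep
  rw [hratio] at hcard
  refine hcard.trans (Real.rpow_le_rpow_of_exponent_le ?_ ?_)
  · have : 0 < 4 * R / r := by positivity
    linarith
  · rw [div_pow ε, mul_assoc, div_mul_eq_mul_div]
    gcongr

theorem card_le_rpow_mul_of_isModel [Fintype A] [DecidableEq A]
    (hG : ∀ i, CylinderLipschitz F L (G i)) (hd : 0 < d) (hr : 0 < r) (hR : 0 < R)
    (hε : ε ≤ r / 8) (hT : ∑ k, ‖T (EuclideanSpace.basisFun _ ℂ k)‖ ^ 2 ≤ ε ^ 2 * d)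
    {s : Finset (Fin d → A)} (hs : ∀ a ∈ s, ∃ c, IsModel σ T G R ε κ a c) {θ N : ℝ}
    (hN0 : 0 ≤ N) (hθ : Fintype.card A * (2 * κ + L * F.card * r) ≤ θ)
    (hN : ∀ b : Fin d → A, ((hammingBall b (θ * d)).card : ℝ) ≤ N) :
    (s.card : ℝ) ≤ (2 + 4 * R / r) ^ (2 * (ε / (r / (8 * R))) ^ 2 * d) * N := by
  choose! c hc using hs
  obtain ⟨t, hts, htsep, htcover⟩ := exists_subset_pairwise_le_dist s c
    (mul_pos hr (Real.sqrt_pos.2 (Nat.cast_pos.2 hd)))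
  have hcover : s ⊆ t.biUnion fun b => hammingBall b (θ * d) := by
    intro a ha
    obtain ⟨b, hb, hab⟩ := htcover a ha
    refine Finset.mem_biUnion.2 ⟨b, hb, mem_hammingBall.2 ?_⟩
    exact ((hc b (hts hb)).hammingDist_le hG (hc a ha) (dist_eq_norm (c b) _ ▸ hab.le)).trans
      (by gcongr)
  calc (s.card : ℝ)
      ≤ ∑ b ∈ t, ((hammingBall b (θ * d)).card : ℝ) := by
        exact_mod_cast (Finset.card_le_card hcover).trans Finset.card_biUnion_le
    _ ≤ t.card * N := by
        rw [← nsmul_eq_mul]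
        exact Finset.sum_le_card_nsmul _ _ _ fun b _ => hN b
    _ ≤ (2 + 4 * R / r) ^ (2 * (ε / (r / (8 * R))) ^ 2 * d) * N := by
        gcongr
        exact card_le_rpow_of_isModel hd hr hR hε hT (fun a ha => hc a (hts ha)) htsep

theorem exists_card_le_exp_of_isModel (A : Type*) [Finite A] {η : ℝ} (hη : 0 < η) :
    ∃ κ > 0, ∀ {Γ : Type*} {F : Finset Γ} {L : ℝ≥0} {G : A → (Γ → ℂ) → ℝ},
      (∀ i, CylinderLipschitz F L (G i)) → ∀ {R : ℝ}, 0 < R → ∃ ε > 0, ∀ {d : ℕ}, 0 < d →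
        ∀ {σ : Γ → Equiv.Perm (Fin d)}
          {T : EuclideanSpace ℂ (Fin d) →ₗ[ℂ] EuclideanSpace ℂ (Fin d)},
        ∑ k, ‖T (EuclideanSpace.basisFun _ ℂ k)‖ ^ 2 ≤ ε ^ 2 * d →
        ∀ s : Finset (Fin d → A), (∀ a ∈ s, ∃ c, IsModel σ T G R ε κ a c) →
          (s.card : ℝ) ≤ Real.exp (η * d) := by
  classical
  have := Fintype.ofFinite A
  obtain ⟨θ, hθ, hball⟩ := exists_card_hammingBall_le_exp A (half_pos hη)
  obtain ⟨κ, hκθ, hκ⟩ := ((eventually_nhdsGT_lt (f := fun κ : ℝ => Fintype.card A * (2 * κ))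
    (x := 0) (t := θ) (by fun_prop) (by simpa using hθ)).and self_mem_nhdsWithin).exists
  refine ⟨κ, hκ, fun {Γ F L G} hG {R} hR => ?_⟩
  obtain ⟨r, hrθ, hr : 0 < r⟩ := ((eventually_nhdsGT_lt
    (f := fun r : ℝ => Fintype.card A * (2 * κ + L * F.card * r)) (x := 0) (t := θ)
    (by fun_prop) (by simpa using hκθ)).and self_mem_nhdsWithin).exists
  have hbase : 0 < 2 + 4 * R / r := by positivity
  obtain ⟨ε, ⟨hεr, hεη⟩, hε⟩ := (((eventually_nhdsGT_lt (f := id) (x := (0 : ℝ)) (t := r / 8)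
      continuousAt_id (by simpa using hr)).and (eventually_nhdsGT_lt
      (f := fun ε : ℝ => Real.log (2 + 4 * R / r) * (2 * (ε / (r / (8 * R))) ^ 2)) (x := 0)
      (t := η / 2) (by fun_prop) (by simpa using hη))).and self_mem_nhdsWithin).exists
  refine ⟨ε, hε, fun {d} hd {σ T} hT s hs => ?_⟩
  calc (s.card : ℝ)
      ≤ (2 + 4 * R / r) ^ (2 * (ε / (r / (8 * R))) ^ 2 * d) * Real.exp (η / 2 * d) :=
        card_le_rpow_mul_of_isModel hG hd hr hR hεr.le hT hs (Real.exp_nonneg _) hrθ.le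
          fun b => by simpa only [Fintype.card_fin] using hball b
    _ ≤ Real.exp (η / 2 * d) * Real.exp (η / 2 * d) := by
        rw [Real.rpow_def_of_pos hbase, ← mul_assoc]
        gcongr
    _ = Real.exp (η * d) := by rw [← Real.exp_add, ← add_mul, add_halves]

end Models

/-! ## Entropy of an action generated by a singular function -/

theorem eventually_add_mul_lt {a b C : ℝ≥0∞} (hC : C ≠ ∞) (hab : a < b) :
    ∀ᶠ t in 𝓝[>] (0 : ℝ≥0∞), a + C * t < b :=
  eventually_nhdsGT_lt
    ((continuous_const.add (ENNReal.continuous_const_mul hC)).continuousAt) (by simpa using hab)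

section Refinement

open scoped NNReal

variable {Γ X : Type*} [Group Γ] [Countable Γ] [MeasurableSpace X] [MulAction Γ X]
  [MeasurableConstSMul Γ X] {μ : Measure X} [IsProbabilityMeasure μ] [SMulInvariantMeasure Γ X μ]

theorem eLpNorm_sub_comp_translates_le {F : Finset Γ} {L : ℝ≥0} {G : (Γ → ℂ) → ℝ}
    (hG : CylinderLipschitz F L G) {ζ w : X → ℂ} (hζ : Measurable ζ) (hw : Measurable w)
    {χ : X → ℝ} (hχ : Measurable χ) :
    eLpNorm (χ - G ∘ translates Γ w) 1 μ ≤
      eLpNorm (χ - G ∘ translates Γ ζ) 1 μ + L * F.card * eLpNorm (ζ - w) 2 μ := by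
  have hGm {z : X → ℂ} (hz : Measurable z) : AEStronglyMeasurable (G ∘ translates Γ z) μ :=
    (hG.continuous.measurable.comp (measurable_translates hz)).aestronglyMeasurable
  calc eLpNorm (χ - G ∘ translates Γ w) 1 μ
      = eLpNorm ((χ - G ∘ translates Γ ζ) + (G ∘ translates Γ ζ - G ∘ translates Γ w)) 1 μ := by
        rw [sub_add_sub_cancel]
    _ ≤ eLpNorm (χ - G ∘ translates Γ ζ) 1 μ +
          eLpNorm (G ∘ translates Γ ζ - G ∘ translates Γ w) 1 μ :=
        eLpNorm_add_le (hχ.aestronglyMeasurable.sub (hGm hζ)) ((hGm hζ).sub (hGm hw)) le_rfl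
    _ ≤ eLpNorm (χ - G ∘ translates Γ ζ) 1 μ + L * F.card * eLpNorm (ζ - w) 1 μ := by
        gcongr
        exact eLpNorm_comp_translates_sub_le hG le_rfl hζ.aestronglyMeasurable
          hw.aestronglyMeasurable
    _ ≤ eLpNorm (χ - G ∘ translates Γ ζ) 1 μ + L * F.card * eLpNorm (ζ - w) 2 μ := by
        gcongr
        exact eLpNorm_le_eLpNorm_of_exponent_le one_le_two (hζ.sub hw).aestronglyMeasurable

theorem exists_refinement_eLpNorm_lt {ζ : X → ℂ} (hζm : Measurable ζ) (hζ : MemLp ζ 2 μ) {k : ℕ}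
    {α : X → Fin k} (hα : Measurable α) {F : Finset Γ} {L : ℝ≥0} {G : Fin k → (Γ → ℂ) → ℝ}
    (hG : ∀ i, CylinderLipschitz F L (G i)) (f : Γ →₀ ℂ) {R ε κ : ℝ≥0∞}
    (hR : eLpNorm ζ 2 μ < R) (hε : eLpNorm (translateSum f ζ - ζ) 2 μ < ε)
    (hκ : ∀ i, eLpNorm ((α ⁻¹' {i}).indicator 1 - G i ∘ translates Γ ζ) 1 μ < κ) :
    ∃ (m : ℕ) (β : X → Fin m) (pr : Fin m → Fin k) (v : Fin m → ℂ), Measurable β ∧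
      (∀ x, pr (β x) = α x) ∧ eLpNorm (v ∘ β) 2 μ < R ∧
      eLpNorm (translateSum f (v ∘ β) - v ∘ β) 2 μ < ε ∧
      ∀ i, eLpNorm ((α ⁻¹' {i}).indicator 1 - G i ∘ translates Γ (v ∘ β)) 1 μ < κ := by
  have hC : (∑ g ∈ f.support, ‖f g‖ₑ) + 1 ≠ ∞ := by
    simp only [ne_eq, ENNReal.add_eq_top, ENNReal.sum_eq_top, enorm_ne_top, ENNReal.one_ne_top,
      and_false, exists_false, or_self, not_false_eq_true]
  have hLF : (L * F.card : ℝ≥0∞) ≠ ∞ := ENNReal.mul_ne_top ENNReal.coe_ne_top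
    (ENNReal.natCast_ne_top _)
  obtain ⟨t, ⟨⟨htR, htε⟩, htκ⟩, ht : 0 < t⟩ := ((((eventually_add_mul_lt ENNReal.one_ne_top hR).and
    (eventually_add_mul_lt hC hε)).and (eventually_all.2 fun i =>
      eventually_add_mul_lt hLF (hκ i))).and self_mem_nhdsWithin).exists
  obtain ⟨m, β, pr, v, hβ, hpr, hv⟩ := exists_refinement hζ ENNReal.ofNat_ne_top hα ht.ne'
  have hw : Measurable (v ∘ β) := (measurable_of_finite v).comp hβ
  have hζw := (hζm.sub hw).aestronglyMeasurable (μ := μ)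
  refine ⟨m, β, pr, v, hβ, hpr, ?_, ?_, fun i => ?_⟩
  · calc eLpNorm (v ∘ β) 2 μ
        = eLpNorm (ζ - (ζ - v ∘ β)) 2 μ := by rw [sub_sub_cancel]
      _ ≤ eLpNorm ζ 2 μ + eLpNorm (ζ - v ∘ β) 2 μ := eLpNorm_sub_le hζ.1 hζw one_le_two
      _ ≤ eLpNorm ζ 2 μ + 1 * t := by
          rw [one_mul]
          gcongr
      _ < R := htR
  · refine (eLpNorm_translateSum_sub_le one_le_two f hζ.1 hw.aestronglyMeasurable).trans_lt ?_
    exact lt_of_le_of_lt (by gcongr) htε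
  · refine (eLpNorm_sub_comp_translates_le (hG i) hζm hw ?_).trans_lt ?_
    · exact measurable_one.indicator (hα (measurableSet_singleton i))
    · exact lt_of_le_of_lt (by gcongr) (htκ i)

end Refinement

theorem norm_le_mul_sqrt {d : ℕ} {c : EuclideanSpace ℂ (Fin d)} {t : ℝ} (ht : 0 ≤ t)
    (h : ∑ j, ‖c j‖ ^ 2 ≤ t ^ 2 * d) : ‖c‖ ≤ t * √d := by
  refine (sq_le_sq₀ (norm_nonneg _) (by positivity)).1 ?_
  rwa [EuclideanSpace.norm_sq_eq, mul_pow, Real.sq_sqrt (Nat.cast_nonneg d)]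

namespace SoficEntropy

section Model

open scoped NNReal

variable {Γ X : Type*} [Group Γ] [MeasurableSpace X] [MulAction Γ X] [MeasurableConstSMul Γ X]
  {μ : Measure X} [IsFiniteMeasure μ]

theorem eventually_isModel_of_mem_AP {k m : ℕ} {β : X → Fin m} (hβ : Measurable β)
    (pr : Fin m → Fin k) (v : Fin m → ℂ) {F : Finset Γ} (hF : (1 : Γ) ∈ F) {L : ℝ≥0}
    {G : Fin k → (Γ → ℂ) → ℝ} (hG : ∀ i, CylinderLipschitz F L (G i)) {f : Γ →₀ ℂ}
    (hf : f.support ⊆ F) {R ε κ : ℝ} (hR : eLpNorm (v ∘ β) 2 μ < ENNReal.ofReal R)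
    (hε : eLpNorm (translateSum f (v ∘ β) - v ∘ β) 2 μ < ENNReal.ofReal ε)
    (hκ : ∀ i, eLpNorm (((pr ∘ β) ⁻¹' {i}).indicator 1 - G i ∘ translates Γ (v ∘ β)) 1 μ <
      ENNReal.ofReal κ) :
    ∀ᶠ δ in 𝓝[>] (0 : ℝ), ∀ (d : ℕ) (σ : Γ → Equiv.Perm (Fin d)), ∀ φ ∈ AP μ β F hF δ σ,
      IsModel σ (soficOperator σ f) G R ε κ (fun j => pr (φ j ⟨1, hF⟩))
        (WithLp.toLp 2 fun j => v (φ j ⟨1, hF⟩)) := by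
  have hpos {x : ℝ≥0∞} {t : ℝ} (h : x < ENNReal.ofReal t) : 0 ≤ t :=
    (ENNReal.ofReal_pos.1 (pos_of_gt h)).le
  let V (a : F → Fin m) : Γ → ℂ := Function.extend Subtype.val (v ∘ a) 0
  have hV (a : F → Fin m) {g : Γ} (hg : g ∈ F) : V a g = v (a ⟨g, hg⟩) :=
    Subtype.val_injective.extend_apply (v ∘ a) 0 ⟨g, hg⟩
  have hVx (x : X) : ∀ g ∈ F, V (itinerary β F x) g = translates Γ (v ∘ β) x g :=
    fun g hg => hV _ hg
  have hsize := eventually_sum_norm_pow_le_of_mem_AP hβ hF (fun b _ => v b) two_ne_zero hR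
  have hfix := eventually_sum_norm_pow_le_of_mem_AP hβ hF (t := ε) (μ := μ)
    (fun b a => ∑ g ∈ f.support, f g * V a g - v b) two_ne_zero <| by
      convert hε using 2
      · ext x
        exact congrArg (· - _) (Finset.sum_congr rfl fun g hg => by rw [hVx x g (hf hg)]; rfl)
      · exact Nat.cast_ofNat
  have hlabel (i : Fin k) := eventually_sum_norm_pow_le_of_mem_AP hβ hF (t := κ) (μ := μ)
    (fun b a => (pr ⁻¹' {i}).indicator (1 : Fin m → ℝ) b - G i (V a)) one_ne_zero <| by
      convert hκ i using 2
      · ext x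
        exact congrArg (_ - ·) ((hG i).congr (hVx x))
      · exact Nat.cast_one
  filter_upwards [hsize, hfix, eventually_all.2 hlabel] with δ hsize hfix hlabel d σ φ hφ
  refine ⟨norm_le_mul_sqrt (hpos hR) (hsize d σ φ hφ), ?_, fun i => ?_⟩
  · rw [norm_sub_rev]
    refine norm_le_mul_sqrt (hpos hε) (le_of_eq_of_le ?_ (hfix d σ φ hφ))
    refine Finset.sum_congr rfl fun j _ => ?_
    rw [PiLp.sub_apply, soficOperator_apply]
    congr 3
    exact Finset.sum_congr rfl fun g hg => by rw [hV _ (hf hg)]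
  · have h := hlabel i d σ φ hφ
    simp only [pow_one, Real.norm_eq_abs] at h
    refine le_of_eq_of_le (Finset.sum_congr rfl fun j _ => ?_) h
    congr 2
    exact (hG i).congr fun g hg => (hV (fun g : F => φ ((σ g)⁻¹ j) ⟨1, hF⟩) hg).symm

end Model

variable {Γ X : Type*} [Group Γ] [MeasurableSpace X] [MulAction Γ X] (S : SoficApproximation Γ)

theorem log_natCast_div_le {N d : ℕ} {η : ℝ} (hd : 0 < d) (h : (N : ℝ) ≤ Real.exp (η * d)) :
    ENNReal.log (N : ℝ≥0∞) / ((d : ℝ) : EReal) ≤ (η : EReal) := by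
  have hd' : (0 : ℝ) < d := Nat.cast_pos.2 hd
  rw [EReal.div_le_iff_le_mul (EReal.coe_pos.2 hd') (EReal.coe_ne_top _)]
  calc ENNReal.log (N : ℝ≥0∞)
      ≤ ENNReal.log (ENNReal.ofReal (Real.exp (η * d))) := by
        rw [← ENNReal.ofReal_natCast]
        exact ENNReal.log_monotone (ENNReal.ofReal_le_ofReal h)
    _ = (d : ℝ) * η := by
        rw [ENNReal.log_ofReal_of_pos (Real.exp_pos _), Real.log_exp, ← EReal.coe_mul, mul_comm]

theorem hLoc_le_of_eventually_ncard_le {μ : Measure X} {k m : ℕ} {β : X → Fin m}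
    {pr : Fin m → Fin k} {F : Finset Γ} {hF : (1 : Γ) ∈ F} {δ η : ℝ}
    (h : ∀ᶠ i in atTop, (((fun (φ : Fin (S.d i) → (F → Fin m)) j => pr (φ j ⟨1, hF⟩)) ''
      AP μ β F hF δ (S.σ i)).ncard : ℝ) ≤ Real.exp (η * S.d i)) :
    hLoc S μ β pr F hF δ ≤ η := by
  refine limsup_le_of_le (by isBoundedDefault) ?_
  filter_upwards [S.eventually_d_pos, h] with i hd hi using log_natCast_div_le hd hi

variable [Countable Γ] [MeasurableConstSMul Γ X] {μ : Measure X} [IsProbabilityMeasure μ]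
  [SMulInvariantMeasure Γ X μ]

theorem hObs_le_of_isSingularFunction {ζ : X → ℂ} (hζm : Measurable ζ) (hζ : MemLp ζ 2 μ)
    (hgen : ‹MeasurableSpace X› ≤ MeasurableSpace.pi.comap (translates Γ ζ))
    (hsing : IsSingularFunction Γ μ ζ) {k : ℕ} {α : X → Fin k} (hα : Measurable α) {η : ℝ}
    (hη : 0 < η) : hObs S μ α ≤ η := by
  classical
  obtain ⟨κ, hκ, hcount⟩ := exists_card_le_exp_of_isModel (Fin k) hη
  obtain ⟨F₀, L, G, hG⟩ := exists_forall_cylinderLipschitz_comp (μ := μ)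
    (measurable_translates hζm) hgen (fun i => hα (measurableSet_singleton i))
    (ENNReal.ofReal_pos.2 (half_pos hκ)).ne'
  have hR : eLpNorm ζ 2 μ < ENNReal.ofReal ((eLpNorm ζ 2 μ).toReal + 1) :=
    (ENNReal.lt_ofReal_iff_toReal_lt hζ.2.ne).2 (lt_add_one _)
  have hR0 : 0 < (eLpNorm ζ 2 μ).toReal + 1 := by positivity
  obtain ⟨ε, hε, hcount⟩ := hcount (fun i => (hG i).1) hR0
  obtain ⟨f, hfζ, hf⟩ := hsing ε hε
  obtain ⟨m, β, pr, v, hβ, hpr, hwR, hwε, hwκ⟩ := exists_refinement_eLpNorm_lt hζm hζ hα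
    (fun i => (hG i).1) f hR hfζ fun i => (hG i).2.trans_lt
      ((ENNReal.ofReal_lt_ofReal_iff hκ).2 (half_lt_self hκ))
  obtain rfl : pr ∘ β = α := funext hpr
  let F : Finset Γ := insert 1 (f.support ∪ F₀)
  have hF : (1 : Γ) ∈ F := Finset.mem_insert_self _ _
  have hfF : f.support ⊆ F := Finset.subset_union_left.trans (Finset.subset_insert _ _)
  have hF₀ : F₀ ⊆ F := Finset.subset_union_right.trans (Finset.subset_insert _ _)
  obtain ⟨δ, hmodel, hδ⟩ := ((eventually_isModel_of_mem_AP hβ pr v hF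
    (fun i => (hG i).1.mono hF₀ le_rfl) hfF hwR hwε hwκ).and self_mem_nhdsWithin).exists
  refine iInf_le_of_le m <| iInf_le_of_le β <| iInf_le_of_le hβ <| iInf_le_of_le pr <|
    iInf_le_of_le (Eventually.of_forall hpr) <| iInf_le_of_le F <| iInf_le_of_le hF <|
    iInf_le_of_le δ <| iInf_le_of_le hδ <| hLoc_le_of_eventually_ncard_le S ?_
  filter_upwards [S.eventually_d_pos, (S.tendsto_hilbertSchmidt f).eventually_lt_const hf]
    with i hd hHS
  rw [Set.ncard_eq_toFinset_card _ (Set.toFinite _)]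
  refine hcount hd (σ := S.σ i) ((div_le_iff₀ (Nat.cast_pos.2 hd)).1 hHS.le) _ fun a ha => ?_
  obtain ⟨φ, hφ, rfl⟩ := (Set.Finite.mem_toFinset _).1 ha
  exact ⟨_, hmodel _ _ φ hφ⟩

theorem entropy_le_zero_of_isSingularFunction {ζ : X → ℂ} (hζm : Measurable ζ)
    (hζ : MemLp ζ 2 μ) (hgen : ‹MeasurableSpace X› ≤ MeasurableSpace.pi.comap (translates Γ ζ))
    (hsing : IsSingularFunction Γ μ ζ) : entropy S μ ≤ 0 :=
  iSup_le fun _ => iSup_le fun _ => iSup_le fun hα => EReal.le_of_forall_lt_iff_le.1 fun _ hη =>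
    hObs_le_of_isSingularFunction S hζm hζ hgen hsing hα (EReal.coe_pos.1 hη)

end SoficEntropy

/-! ## The factor generated by a function -/

theorem IsSingularFunction.of_comp {Γ X Y : Type*} [Group Γ] [MulAction Γ X] [MulAction Γ Y]
    [MeasurableSpace X] [MeasurableSpace Y] [MeasurableConstSMul Γ Y] {μ : Measure X}
    {ν : Measure Y} [SMulInvariantMeasure Γ Y ν] {Φ : X → Y} (hΦ : MeasurePreserving Φ μ ν)
    (hsmul : ∀ (g : Γ) x, Φ (g • x) = g • Φ x) {ζ : Y → ℂ} (hζ : AEStronglyMeasurable ζ ν)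
    (h : IsSingularFunction Γ μ (ζ ∘ Φ)) : IsSingularFunction Γ ν ζ := by
  intro ε hε
  obtain ⟨f, hfζ, hf⟩ := h ε hε
  have hcomp : translateSum f (ζ ∘ Φ) - ζ ∘ Φ = (translateSum f ζ - ζ) ∘ Φ := by
    ext x
    simp only [translateSum, Pi.sub_apply, Function.comp_apply, hsmul]
  rw [hcomp, eLpNorm_comp_measurePreserving ((aestronglyMeasurable_translateSum f hζ).sub hζ) hΦ]
    at hfζ
  exact ⟨f, hfζ, hf⟩

/-- The shift `ℂ^Γ` of the countable group `Γ`. It is built on `Shrink Γ` so that it lives in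
`Type`, whatever the universe of `Γ`. -/
def ShiftSpace (Γ : Type*) [Countable Γ] : Type := Shrink.{0} Γ → ℂ

namespace ShiftSpace

variable {Γ : Type*} [Countable Γ]

noncomputable instance : MeasurableSpace (ShiftSpace Γ) :=
  inferInstanceAs (MeasurableSpace (Shrink.{0} Γ → ℂ))

instance : StandardBorelSpace (ShiftSpace Γ) :=
  haveI : Countable (Shrink.{0} Γ) := (equivShrink.{0} Γ).symm.injective.countable
  inferInstanceAs (StandardBorelSpace (Shrink.{0} Γ → ℂ))

/-- The coordinate of a point of the shift at `g`. -/
noncomputable def coord (g : Γ) (y : ShiftSpace Γ) : ℂ := y (equivShrink.{0} Γ g)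

/-- The point of the shift with given coordinates. -/
noncomputable def ofFun (z : Γ → ℂ) : ShiftSpace Γ := fun s => z ((equivShrink.{0} Γ).symm s)

@[simp] theorem coord_ofFun (z : Γ → ℂ) (g : Γ) : coord g (ofFun z) = z g := by
  simp [coord, ofFun]

@[simp] theorem ofFun_coord (y : ShiftSpace Γ) : (ofFun fun g => coord g y) = y := by
  funext s
  simp [coord, ofFun]

theorem measurable_coord (g : Γ) : Measurable (coord g : ShiftSpace Γ → ℂ) :=
  measurable_pi_apply (X := fun _ : Shrink.{0} Γ => ℂ) _

theorem measurable_ofFun : Measurable (ofFun : (Γ → ℂ) → ShiftSpace Γ) :=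
  measurable_pi_lambda (X := fun _ : Shrink.{0} Γ => ℂ) _ fun _ => measurable_pi_apply _

variable [Group Γ]

noncomputable instance : MulAction Γ (ShiftSpace Γ) where
  smul g y := ofFun fun h => coord (g⁻¹ * h) y
  one_smul y := by
    change ofFun (fun h => coord (1⁻¹ * h) y) = y
    simp
  mul_smul g g' y := by
    change ofFun (fun h => coord ((g * g')⁻¹ * h) y) =
      ofFun (fun h => coord (g⁻¹ * h) (ofFun fun h => coord (g'⁻¹ * h) y))
    simp [mul_assoc]

theorem smul_def (g : Γ) (y : ShiftSpace Γ) : g • y = ofFun fun h => coord (g⁻¹ * h) y := rfl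

instance : MeasurableConstSMul Γ (ShiftSpace Γ) where
  measurable_const_smul g :=
    measurable_ofFun.comp (measurable_pi_lambda _ fun h => measurable_coord (g⁻¹ * h))

theorem ofFun_translates_coord_one (y : ShiftSpace Γ) : ofFun (translates Γ (coord 1) y) = y := by
  have htranslates : translates Γ (coord 1) y = fun g => coord g y := by
    ext g
    simp [translates, smul_def]
  rw [htranslates, ofFun_coord]

theorem measurableSpace_le_comap_translates :
    (inferInstance : MeasurableSpace (ShiftSpace Γ)) ≤
      MeasurableSpace.pi.comap (translates Γ (coord (1 : Γ))) := fun E hE =>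
  ⟨ofFun ⁻¹' E, measurable_ofFun hE, by
    rw [← Set.preimage_comp, funext ofFun_translates_coord_one (f := ofFun ∘ _) (g := id),
      Set.preimage_id]⟩

variable {X : Type*} [MulAction Γ X]

theorem ofFun_translates_smul (ζ : X → ℂ) (g : Γ) (x : X) :
    ofFun (translates Γ ζ (g • x)) = g • ofFun (translates Γ ζ x) := by
  rw [smul_def]
  congr 1
  ext h
  simp [translates, mul_smul]

theorem coord_one_comp_ofFun_translates (ζ : X → ℂ) :
    coord (1 : Γ) ∘ ofFun ∘ translates Γ ζ = ζ := by
  ext x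
  simp [translates]

end ShiftSpace

/-- By way of `x ↦ (g ↦ ζ (g⁻¹ x))` the function `ζ` is the pullback of the coordinate at `1`, which
generates the σ-algebra of the shift. -/
theorem HasCompletelyPositiveEntropy.ae_eq_const_of_isSingularFunction {Γ X : Type*} [Group Γ]
    [Countable Γ] {S : SoficApproximation Γ} [MeasurableSpace X] [MulAction Γ X]
    [MeasurableConstSMul Γ X] {μ : Measure X} [IsProbabilityMeasure μ]
    [SMulInvariantMeasure Γ X μ] (hcpe : HasCompletelyPositiveEntropy S μ) {ζ : X → ℂ}
    (hζm : Measurable ζ) (hζ : MemLp ζ 2 μ) (hsing : IsSingularFunction Γ μ ζ) :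
    ∃ c : ℂ, ζ =ᵐ[μ] fun _ => c := by
  let Φ : X → ShiftSpace Γ := ShiftSpace.ofFun ∘ translates Γ ζ
  let ν : Measure (ShiftSpace Γ) := μ.map Φ
  have hΦ : MeasurePreserving Φ μ ν :=
    ⟨ShiftSpace.measurable_ofFun.comp (measurable_translates hζm), rfl⟩
  have hsmul (g : Γ) (x : X) : Φ (g • x) = g • Φ x := ShiftSpace.ofFun_translates_smul ζ g x
  have hcoord : ShiftSpace.coord (1 : Γ) ∘ Φ = ζ := ShiftSpace.coord_one_comp_ofFun_translates ζ
  have hmeas := ShiftSpace.measurable_coord (1 : Γ)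
  have : IsProbabilityMeasure ν := Measure.isProbabilityMeasure_map hΦ.measurable.aemeasurable
  have : SMulInvariantMeasure Γ (ShiftSpace Γ) ν := smulInvariantMeasure_map μ Φ hsmul hΦ.measurable
  have hentropy : SoficEntropy.entropy S ν ≤ 0 :=
    SoficEntropy.entropy_le_zero_of_isSingularFunction S hmeas
      ((memLp_map_measure_iff hmeas.aestronglyMeasurable hΦ.measurable.aemeasurable).2
        (hcoord ▸ hζ))
      ShiftSpace.measurableSpace_le_comap_translates
      (IsSingularFunction.of_comp hΦ hsmul hmeas.aestronglyMeasurable (hcoord ▸ hsing))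
  by_contra! hne
  refine hentropy.not_gt (hcpe _ ν ⟨Φ, hΦ, fun g => .of_forall (hsmul g)⟩ fun y hy => ?_)
  refine hne (ShiftSpace.coord 1 y) ?_
  have hy_ae : ∀ᵐ y' ∂ν, ShiftSpace.coord 1 y' = ShiftSpace.coord (1 : Γ) y := by
    have hs : MeasurableSet {y' | ShiftSpace.coord (1 : Γ) y' = ShiftSpace.coord 1 y} :=
      hmeas (measurableSet_singleton _)
    rw [hy, ae_dirac_iff hs]
  filter_upwards [hΦ.quasiMeasurePreserving.ae hy_ae] with x hx
  rwa [← Function.comp_apply (f := ShiftSpace.coord 1), hcoord] at hx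

/-! ## The Koopman representation -/

namespace UnitaryRep

section Koopman

variable {Γ X : Type*} [Group Γ] [MeasurableSpace X] [MulAction Γ X] [MeasurableConstSMul Γ X]
  {μ : Measure X} [SMulInvariantMeasure Γ X μ]

theorem orbitMap_koopmanFull_ae_eq (ξ : Lp ℂ 2 μ) (f : Γ →₀ ℂ) :
    (koopmanFull Γ μ).orbitMap ξ f =ᵐ[μ] translateSum f ξ := by
  have hterm : ∀ᵐ x ∂μ, ∀ g ∈ f.support,
      (f g • koopmanFull Γ μ g ξ : Lp ℂ 2 μ) x = f g * ξ (g⁻¹ • x) := by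
    refine (Finset.eventually_all _).2 fun g _ => ?_
    filter_upwards [Lp.coeFn_smul (f g) (koopmanFull Γ μ g ξ), koopmanFull_ae_eq μ g ξ]
      with x hsmul hkoopman
    rw [hsmul, Pi.smul_apply, hkoopman, smul_eq_mul]
  filter_upwards [hterm, Lp.coeFn_fun_finsetSum f.support fun g => f g • koopmanFull Γ μ g ξ]
    with x hterm hsum
  rw [orbitMap_apply, hsum]
  exact Finset.sum_congr rfl hterm

theorem coe_orbitMap_koopman [IsFiniteMeasure μ] (ξ : L2Zero μ) (f : Γ →₀ ℂ) :
    ((koopman Γ μ).orbitMap ξ f : Lp ℂ 2 μ) = (koopmanFull Γ μ).orbitMap ξ f := by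
  simp only [orbitMap_apply, Submodule.coe_sum, Submodule.coe_smul]
  rfl

theorem IsSingularVector.isSingularFunction [IsFiniteMeasure μ] {ξ : L2Zero μ}
    (h : (koopman Γ μ).IsSingularVector ξ) : IsSingularFunction Γ μ (ξ : Lp ℂ 2 μ) := by
  intro ε hε
  obtain ⟨f, hfξ, hf⟩ := h ε hε
  refine ⟨f, ?_, hf⟩
  have hae : (((koopman Γ μ).orbitMap ξ f - ξ : L2Zero μ) : Lp ℂ 2 μ) =ᵐ[μ]
      translateSum f (ξ : Lp ℂ 2 μ) - (ξ : Lp ℂ 2 μ) := by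
    rw [AddSubgroupClass.coe_sub, coe_orbitMap_koopman]
    exact (Lp.coeFn_sub _ _).trans ((orbitMap_koopmanFull_ae_eq _ f).sub .rfl)
  rw [← eLpNorm_congr_ae hae, ← Lp.enorm_def, ← ofReal_norm]
  exact (ENNReal.ofReal_lt_ofReal_iff hε).2 hfξ

end Koopman

theorem eq_zero_of_mem_L2Zero_of_ae_eq_const {X : Type*} [MeasurableSpace X] {μ : Measure X}
    [IsFiniteMeasure μ] {ξ : Lp ℂ 2 μ} (hξ : ξ ∈ L2Zero μ) {c : ℂ} (h : ξ =ᵐ[μ] fun _ => c) :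
    ξ = 0 := by
  have hconst : c • Lp.const 2 μ (1 : ℂ) = ξ := calc
    c • Lp.const 2 μ (1 : ℂ) = Lp.const 2 μ c := by
      simpa using ((Lp.constₗ 2 μ ℂ).map_smul c (1 : ℂ)).symm
    _ = ξ := Lp.ext ((Lp.coeFn_const 2 μ c).trans h.symm)
  have hmem : ξ ∈ Submodule.span ℂ {Lp.const 2 μ (1 : ℂ)} :=
    Submodule.mem_span_singleton.2 ⟨c, hconst⟩
  exact inner_self_eq_zero.1 (Submodule.inner_right_of_mem_orthogonal hmem hξ)

end UnitaryRep

theorem corollary1p2_general {Γ X : Type*} [Group Γ] [Countable Γ] (S : SoficApproximation Γ)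
    [MeasurableSpace X] [MulAction Γ X] [MeasurableConstSMul Γ X] (μ : Measure X) [IsSeparable μ]
    [IsProbabilityMeasure μ] [SMulInvariantMeasure Γ X μ]
    (hcpe : HasCompletelyPositiveEntropy S μ) :
    (UnitaryRep.koopman Γ μ).Embeds (UnitaryRep.directSum ℕ (UnitaryRep.leftRegular Γ)) := by
  have : CompleteSpace (UnitaryRep.L2Zero μ) := Submodule.instOrthogonalCompleteSpace _
  have : Fact ((2 : ℝ≥0∞) ≠ ∞) := ⟨by norm_num⟩
  refine UnitaryRep.embeds_of_forall_isSingularVector fun ξ hξ => ?_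
  obtain ⟨c, hc⟩ := hcpe.ae_eq_const_of_isSingularFunction
    (Lp.stronglyMeasurable (ξ : Lp ℂ 2 μ)).measurable (Lp.memLp _) hξ.isSingularFunction
  exact Subtype.ext (UnitaryRep.eq_zero_of_mem_L2Zero_of_ae_eq_const ξ.2 hc)

theorem corollary1p2 {Γ X : Type*} [Group Γ] [Countable Γ] (S : SoficApproximation Γ)
    [MeasurableSpace X] [StandardBorelSpace X] [MulAction Γ X] [MeasurableConstSMul Γ X]
    (μ : MeasureTheory.Measure X) [MeasureTheory.IsProbabilityMeasure μ]
    [MeasureTheory.SMulInvariantMeasure Γ X μ]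
    (hcpe : HasCompletelyPositiveEntropy S μ) :
    (UnitaryRep.koopman Γ μ).Embeds
      (UnitaryRep.directSum ℕ (UnitaryRep.leftRegular Γ)) :=
  corollary1p2_general S μ hcpe
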